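/- Let $d\ge 1$, $0<\alpha<2$ and $0<\kappa_0<\kappa_1$. There exist constants $C_1,C_2>0$ depending only on $d,\alpha,\kappa_0,\kappa_1$ such that the following holds. Let $K:\mathbb{R}^d\to\mathbb{R}$ be a measurable function with $$\frac{\kappa_0}{|h|^{d+\alpha}}\le K(h)\le\frac{\kappa_1}{|h|^{d+\alpha}},\qquad h\in\mathbb{R}^d\setminus\{0\},$$ and, in the case $\alpha=1$, assume in addition that $\int_{\partial B_r}K(h)\,h\,\mathrm{d}S_r(h)=0$ for all $r>0$, where $\mathrm{d}S_r$ is the surface measure on the sphere $\partial B_r=\{|h|=r\}$. Put $\chi_\alpha(h)=\mathbf 1_{\alpha>1}+\mathbf 1_{\alpha=1}\mathbf 1_{\{|h|\le1\}}$, $$\psi(u)=-\int_{\mathbb{R}^d\setminus\{0\}}\Big(e^{iu\cdot h}-1-\chi_\alpha(h)\,iu\cdot h\Big)K(h)\,\mathrm{d}h,\qquad u\in\mathbb{R}^d,$$ and $$f_t(x)=\frac1{(2\pi)^d}\int_{\mathbb{R}^d}e^{-iu\cdot x}e^{-t\psi(u)}\,\mathrm{d}u,\qquad x\in\mathbb{R}^d,\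 t>0,$$ where the last integral converges absolutely. If $Z=(Z_t)_{t\ge0}$ is a Lévy process in $\mathbb{R}^d$ with $Z_0=0$ a.s. and $\mathbf E[e^{iZ_t\cdot u}]=e^{-t\psi(u)}$ for all $t\ge0$, $u\in\mathbb{R}^d$, then for every $t>0$ the function $f_t$ is nonnegative and is the density of the law of $Z_t$ with respect to Lebesgue measure. Moreover, for all $t>0$ and $x\in\mathbb{R}^d$, $$f_t(x)\le C_1\,t\,\big(t^{1/\alpha}+|x|\big)^{-d-\alpha},$$ and $f_t$ is differentiable at $x$ with $$|\nabla f_t(x)|\le C_2\,t^{1-1/\alpha}\big(t^{1/\alpha}+|x|\big)^{-d-\alpha}.$$ -/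

import Mathlib

open MeasureTheory ProbabilityTheory Filter Topology
open scoped NNReal ENNReal

noncomputable section

namespace StableLike

/-- The Euclidean space `ℝ^d`. -/
abbrev Rd (d : ℕ) : Type := EuclideanSpace ℝ (Fin d)

/-- The surface measure on the sphere `∂B_r` of radius `r` centred at `0`, as a measure on `ℝ^d`:
the surface measure of the unit sphere, transported by `ω ↦ r ω` and multiplied by `r^(d-1)`. -/
def surfaceMeasure (d : ℕ) (r : ℝ) : Measure (Rd d) :=
  ENNReal.ofReal (r ^ (d - 1)) •
    Measure.map (fun ω : Metric.sphere (0 : Rd d) 1 => r • (ω : Rd d))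
      (volume : Measure (Rd d)).toSphere

/-- The compensator weight `χ_α(h) = 1_{α > 1} + 1_{α = 1} 1_{|h| ≤ 1}`. -/
def chi {d : ℕ} (α : ℝ) (h : Rd d) : ℝ :=
  (if 1 < α then 1 else 0) + (if α = 1 ∧ ‖h‖ ≤ 1 then 1 else 0)

/-- `K` is a jump kernel comparable to `|h|^(-d-α)` with constants `κ₀`, `κ₁`; if `α = 1`, the
first moment of `K` over every sphere centred at `0` vanishes. -/
structure IsStableLikeKernel {d : ℕ} (α κ₀ κ₁ : ℝ) (K : Rd d → ℝ) : Prop where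
  measurable : Measurable K
  lower : ∀ h : Rd d, h ≠ 0 → κ₀ / ‖h‖ ^ ((d : ℝ) + α) ≤ K h
  upper : ∀ h : Rd d, h ≠ 0 → K h ≤ κ₁ / ‖h‖ ^ ((d : ℝ) + α)
  moment : α = 1 → ∀ r : ℝ, 0 < r → ∫ h, K h • h ∂(surfaceMeasure d r) = 0

/-- The characteristic exponent
`ψ(u) = -∫_{ℝ^d ∖ {0}} (e^{i u·h} - 1 - χ_α(h) i u·h) K(h) dh`. -/
def psi {d : ℕ} (α : ℝ) (K : Rd d → ℝ) (u : Rd d) : ℂ :=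
  -∫ h in ({0}ᶜ : Set (Rd d)),
    (Complex.exp (Complex.I * (inner ℝ u h : ℝ)) - 1
      - (chi α h : ℂ) * (Complex.I * (inner ℝ u h : ℝ))) * (K h : ℂ)

/-- The function `f_t(x) = (2π)^{-d} ∫ e^{-i u·x} e^{-t ψ(u)} du`. Since `ψ(-u)` is the complex
conjugate of `ψ(u)`, the integral is real. -/
def density {d : ℕ} (α : ℝ) (K : Rd d → ℝ) (t : ℝ) (x : Rd d) : ℝ :=
  (1 / (2 * Real.pi) ^ d) *
    (∫ u : Rd d, Complex.exp (-(Complex.I * (inner ℝ u x : ℝ)))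
      * Complex.exp (-((t : ℂ) * psi α K u))).re

/-- `Z` is an `ℝ^d`-valued Lévy process with `Z_0 = 0` a.s.: independent and stationary increments,
stochastically continuous, with almost surely càdlàg paths. -/
structure IsLevyProcess {d : ℕ} {Ω : Type*} [MeasurableSpace Ω] (Z : ℝ≥0 → Ω → Rd d)
    (P : Measure Ω) : Prop where
  measurable : ∀ t, Measurable (Z t)
  zero : ∀ᵐ ω ∂P, Z 0 ω = 0
  indep : HasIndepIncrements Z P
  stationary : ∀ s t : ℝ≥0, P.map (fun ω => Z (s + t) ω - Z s ω) = P.map (Z t)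
  stochCont : ∀ t : ℝ≥0, TendstoInMeasure P Z (𝓝 t) (Z t)
  cadlag : ∀ᵐ ω ∂P, ∀ t : ℝ≥0, ContinuousWithinAt (fun s => Z s ω) (Set.Ici t) t ∧
    ∃ l : Rd d, Tendsto (fun s => Z s ω) (𝓝[<] t) (𝓝 l)

/-- `Z` is a Lévy process with `E[e^{i Z_t·u}] = e^{-t ψ(u)}`. -/
structure IsStableLikeProcess {d : ℕ} {Ω : Type*} [MeasurableSpace Ω] (α : ℝ) (K : Rd d → ℝ)
    (Z : ℝ≥0 → Ω → Rd d) (P : Measure Ω) : Prop where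
  levy : IsLevyProcess Z P
  charFun_eq : ∀ (t : ℝ≥0) (u : Rd d),
    ∫ ω, Complex.exp (Complex.I * (inner ℝ (Z t ω) u : ℝ)) ∂P
      = Complex.exp (-(((t : ℝ) : ℂ) * psi α K u))

end StableLike

end

namespace StableLike

open Module (finrank)

set_option linter.unusedSectionVars false
set_option maxSynthPendingDepth 3

section General

variable {E : Type*} [NormedAddCommGroup E] [InnerProductSpace ℝ E] [FiniteDimensional ℝ E]
  [MeasurableSpace E] [BorelSpace E]


/-! ### Integrability of powers of the norm -/

/-! Everything reduces to time one by scaling. With `r = t ^ (1 / α)`, the kernel `r ^ (d + α) * K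
(r • h)` satisfies the same two-sided bounds as `K`, and `exp (-t ψ(u))` is a time-one
characteristic function at `r • u`. Scaling spoils the compensator; returning to the cutoff on the
unit ball costs a drift, bounded uniformly in `r` (`drift_bounds`): by integrability of `|h| ^ (1 -
d - α)` near 0 if `α < 1`, at infinity if `α > 1`, and by the sphere condition if `α = 1`.

At time one the characteristic function factors into small jumps with drift and a compound Poisson
part. The small-jump exponent is smooth: its second derivative is the Fourier transform of an
integrable weight supported in the unit ball, so all derivatives of order at least 2 are bounded.
Its real part is at most `-c |u| ^ α` for `|u| ≥ 1` (`re_compensated_le`), so the small-jump factor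
and its derivatives decay faster than any power, and its Fourier transform and gradient decay like
`(1 + |x|) ^ (-(d + 2))` (`exists_fourierI_decay`).

The compound Poisson factor is expanded into its exponential series. Each power of the transformed
tail acts as a convolution, and the profile `(1 + |x|) ^ (-d - α)` convolved with itself is at most
a constant times itself. Hence the n-th term costs `c ^ n / n!`, and the series preserves the
profile bound (`norm_fourierI_mul_exp_weightHat_le`). The gradient is treated alike, the factor `⟨u,
e⟩` being attached to the small jumps.

The bound makes `f_t` integrable, so Fourier inversion applies; uniqueness of characteristic
functions then identifies the law and forces `f_t ≥ 0` (`eq_withDensity_of_charFun`). -/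

theorem integrableOn_norm_rpow_closedBall [Nontrivial E] {s : ℝ} (hs : -(finrank ℝ E : ℝ) < s) :
    IntegrableOn (fun h : E => ‖h‖ ^ s) (Metric.closedBall 0 1) := by
  have h1 : Integrable (fun h : E => (Set.Iic (1 : ℝ)).indicator (fun r => r ^ s) ‖h‖) := by
    rw [integrable_fun_norm_addHaar (volume : Measure (E))
      (f := (Set.Iic (1 : ℝ)).indicator (fun r => r ^ s))]
    have h2 : IntegrableOn (fun y : ℝ => y ^ ((finrank ℝ E : ℝ) - 1 + s)) (Set.Ioc 0 1) := by
      rw [← intervalIntegrable_iff_integrableOn_Ioc_of_le zero_le_one]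
      exact intervalIntegral.intervalIntegrable_rpow' (by linarith)
    have h3 : IntegrableOn ((Set.Iic (1 : ℝ)).indicator (fun y : ℝ => y ^ ((finrank ℝ E : ℝ) - 1 + s)))
        (Set.Ioi 0) := by
      rw [integrableOn_indicator_iff measurableSet_Iic]
      have : Set.Iic (1 : ℝ) ∩ Set.Ioi 0 = Set.Ioc 0 1 := by ext; simp [and_comm]
      rwa [this]
    refine h3.congr_fun (fun y hy => ?_) measurableSet_Ioi
    simp only [smul_eq_mul, Set.indicator]
    split_ifs
    · rw [Real.rpow_add hy]
      congr 1
      rw [← Real.rpow_natCast, Nat.cast_sub Module.finrank_pos, Nat.cast_one]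
    · simp
  rw [← integrable_indicator_iff measurableSet_closedBall]
  refine h1.congr (Eventually.of_forall fun h => ?_)
  simp [Set.indicator]

theorem integrableOn_norm_rpow_compl_closedBall {s : ℝ} (hs : s < -(finrank ℝ E : ℝ)) :
    IntegrableOn (fun h : E => ‖h‖ ^ s) (Metric.closedBall 0 1)ᶜ := by
  have h1 : Integrable (fun h : E => (1 + ‖h‖) ^ s) := by
    simpa using integrable_one_add_norm (E := E) (μ := volume) (r := -s) (by linarith)
  refine ((h1.const_mul (2 ^ (-s))).integrableOn (s := (Metric.closedBall 0 1)ᶜ)).mono'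
    (measurable_norm.pow_const s).aestronglyMeasurable ?_
  refine (ae_restrict_iff' measurableSet_closedBall.compl).2 (Eventually.of_forall fun h hh => ?_)
  have hh1 : 1 < ‖h‖ := by simpa using hh
  rw [Real.norm_of_nonneg (by positivity)]
  have h0 : (0 : ℝ) < ‖h‖ := by linarith
  have hd0 : (0 : ℝ) ≤ finrank ℝ E := Nat.cast_nonneg _
  calc ‖h‖ ^ s = 2 ^ (-s) * (2 * ‖h‖) ^ s := by
        rw [Real.mul_rpow (by norm_num) h0.le, ← mul_assoc, ← Real.rpow_add (by norm_num)]; simp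
    _ ≤ 2 ^ (-s) * (1 + ‖h‖) ^ s := by
        gcongr ?_ * ?_
        exact Real.rpow_le_rpow_of_nonpos (by positivity) (by linarith) (by linarith)

/-! ### Smoothness of the small-jump exponent -/

/-- Mean value inequality: the derivative `i (e^{ix} - 1)` has norm at most `|x| ≤ |θ|` between 0
and `θ`. The sharp constant 1/2 is not needed. -/
theorem norm_exp_I_mul_sub_one_sub_le (θ : ℝ) :
    ‖Complex.exp (Complex.I * θ) - 1 - Complex.I * θ‖ ≤ |θ| ^ 2 := by
  have hder : ∀ x : ℝ, HasDerivAt (fun x : ℝ => Complex.exp (Complex.I * x) - 1 - Complex.I * x)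
      (Complex.I * (Complex.exp (Complex.I * x) - 1)) x := by
    intro x
    have h1 : HasDerivAt (fun x : ℝ => Complex.I * (x : ℂ)) Complex.I x := by
      simpa using (Complex.ofRealCLM.hasDerivAt (x := x)).const_mul Complex.I
    refine ((h1.cexp.sub_const 1).sub h1).congr_deriv ?_
    ring
  have := (convex_uIcc (0 : ℝ) θ).norm_image_sub_le_of_norm_hasDerivWithin_le (C := |θ|)
    (fun x _ => (hder x).hasDerivWithinAt) (fun x hx => ?_) Set.left_mem_uIcc Set.right_mem_uIcc
  · simpa [pow_two] using this
  · rw [norm_mul, Complex.norm_I, one_mul]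
    refine (Real.norm_exp_I_mul_ofReal_sub_one_le).trans ?_
    rw [Real.norm_eq_abs]
    simpa using Set.abs_sub_left_of_mem_uIcc hx

/-- The exponent of the compensated jumps with weight `k`. -/
noncomputable def compensated (k : E → ℝ) (u : E) : ℂ :=
  ∫ h, (Complex.exp (Complex.I * (inner ℝ u h : ℝ)) - 1 - Complex.I * (inner ℝ u h : ℝ)) * (k h : ℂ)

/-- The functional `u ↦ ⟨h, u⟩`, with complex values. -/
noncomputable def innerC (h : E) : E →L[ℝ] ℂ := Complex.ofRealCLM.comp (innerSL ℝ h)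

theorem innerC_apply (h u : E) : innerC h u = ((inner ℝ u h : ℝ) : ℂ) := by
  simp [innerC, real_inner_comm]

theorem norm_innerC_le (h : E) : ‖innerC h‖ ≤ ‖h‖ := by
  refine ContinuousLinearMap.opNorm_le_bound _ (norm_nonneg _) fun u => ?_
  rw [innerC_apply, Complex.norm_real, mul_comm]
  exact norm_inner_le_norm u h

theorem continuous_innerC : Continuous (innerC (E := E)) := by
  have : (innerC (E := E)) = fun h =>
      ContinuousLinearMap.compL ℝ (E) ℝ ℂ Complex.ofRealCLM (innerSL ℝ h) := rfl
  rw [this]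
  fun_prop

theorem hasFDerivAt_innerC (h u : E) :
    HasFDerivAt (fun u : E => ((inner ℝ u h : ℝ) : ℂ)) (innerC h) u := by
  simpa only [← innerC_apply] using (innerC h).hasFDerivAt (x := u)

theorem hasFDerivAt_exp_inner (h u : E) :
    HasFDerivAt (fun u : E => Complex.exp (Complex.I * (inner ℝ u h : ℝ)))
      ((Complex.I * Complex.exp (Complex.I * (inner ℝ u h : ℝ))) • innerC h) u := by
  refine ((hasFDerivAt_innerC h u).const_mul Complex.I).cexp.congr_fderiv ?_
  rw [smul_smul, mul_comm]

theorem norm_exp_I_inner (u h : E) : ‖Complex.exp (Complex.I * (inner ℝ u h : ℝ))‖ = 1 := by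
  rw [mul_comm]; exact Complex.norm_exp_ofReal_mul_I _

theorem norm_exp_I_inner_sub_one_le (u h : E) :
    ‖Complex.exp (Complex.I * (inner ℝ u h : ℝ)) - 1‖ ≤ ‖u‖ * ‖h‖ :=
  Real.norm_exp_I_mul_ofReal_sub_one_le.trans (norm_inner_le_norm (𝕜 := ℝ) u h)

theorem norm_compensator_le (u h : E) :
    ‖Complex.exp (Complex.I * (inner ℝ u h : ℝ)) - 1 - Complex.I * (inner ℝ u h : ℝ)‖
      ≤ ‖u‖ ^ 2 * ‖h‖ ^ 2 := by
  refine (norm_exp_I_mul_sub_one_sub_le _).trans ?_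
  rw [← mul_pow]
  gcongr
  exact norm_inner_le_norm (𝕜 := ℝ) u h

section Compensated

variable {k : E → ℝ}

theorem integrable_compensated (hkm : Measurable k) (hk : Integrable fun h => ‖h‖ ^ 2 * |k h|)
    (u : E) :
    Integrable fun h => (Complex.exp (Complex.I * (inner ℝ u h : ℝ)) - 1
      - Complex.I * (inner ℝ u h : ℝ)) * (k h : ℂ) := by
  refine (hk.const_mul (‖u‖ ^ 2)).mono' (by fun_prop) (Eventually.of_forall fun h => ?_)
  rw [norm_mul, Complex.norm_real, Real.norm_eq_abs, ← mul_assoc]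
  gcongr
  exact norm_compensator_le u h

theorem measurable_compensated_deriv (hkm : Measurable k) (u : E) : Measurable fun h : E =>
    Complex.I * (Complex.exp (Complex.I * (inner ℝ u h : ℝ)) - 1) * (k h : ℂ) := by
  fun_prop

/-- Differentiation under the integral. Since `|e^{i⟨u,h⟩} - 1| ≤ |u| |h|`, the differentiated
integrand is still controlled by the second moment, locally uniformly in `u`. -/
theorem hasFDerivAt_compensated (hkm : Measurable k) (hk : Integrable fun h => ‖h‖ ^ 2 * |k h|)
    (u : E) :
    HasFDerivAt (compensated k)
      (∫ h, (Complex.I * (Complex.exp (Complex.I * (inner ℝ u h : ℝ)) - 1) * (k h : ℂ)) •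
        innerC h) u := by
  refine hasFDerivAt_integral_of_dominated_of_fderiv_le (Metric.ball_mem_nhds u one_pos)
    (F := fun u h => (Complex.exp (Complex.I * (inner ℝ u h : ℝ)) - 1
      - Complex.I * (inner ℝ u h : ℝ)) * (k h : ℂ))
    (F' := fun u h => (Complex.I * (Complex.exp (Complex.I * (inner ℝ u h : ℝ)) - 1) * (k h : ℂ)) •
        innerC h) (bound := fun h => (‖u‖ + 1) * (‖h‖ ^ 2 * |k h|))
    (Eventually.of_forall fun v => (integrable_compensated hkm hk v).1)
    (integrable_compensated hkm hk u) ?_ ?_ (hk.const_mul _) ?_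
  · exact AEStronglyMeasurable.smul (measurable_compensated_deriv hkm _).aestronglyMeasurable continuous_innerC.aestronglyMeasurable
  · refine Eventually.of_forall fun h v hv => ?_
    have hv' : ‖v‖ ≤ ‖u‖ + 1 := by
      have := norm_le_norm_add_norm_sub' v u
      rw [mem_ball_iff_norm] at hv; linarith
    rw [norm_smul, norm_mul, norm_mul, Complex.norm_I, one_mul, Complex.norm_real,
      Real.norm_eq_abs]
    calc _ ≤ ((‖u‖ + 1) * ‖h‖) * |k h| * ‖h‖ := by
          gcongr
          · exact (norm_exp_I_inner_sub_one_le v h).trans (by gcongr)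
          · exact norm_innerC_le h
      _ = _ := by ring
  · refine Eventually.of_forall fun h v hv => ?_
    have := (((hasFDerivAt_exp_inner h v).sub_const 1).sub
      ((hasFDerivAt_innerC h v).const_mul Complex.I)).mul_const (k h : ℂ)
    refine this.congr_fderiv ?_
    ext w
    simp
    ring

/-- The scaled inner product for which `VectorFourier.fourierIntegral` has the kernel
`exp (-i ⟨u, x⟩)`. -/
noncomputable def scaledInner (E : Type*) [NormedAddCommGroup E] [InnerProductSpace ℝ E] : E →L[ℝ] E →L[ℝ] ℝ := (2 * Real.pi)⁻¹ • innerSL ℝ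

theorem scaledInner_apply (u x : E) : scaledInner E u x = (2 * Real.pi)⁻¹ * inner ℝ u x := by
  rfl

theorem norm_scaledInner_le : 2 * Real.pi * ‖scaledInner E‖ ≤ 1 := by
  have : ‖scaledInner E‖ ≤ (2 * Real.pi)⁻¹ := by
    refine ContinuousLinearMap.opNorm_le_bound₂ _ (by positivity) fun u x => ?_
    rw [scaledInner_apply, norm_mul, Real.norm_of_nonneg (by positivity), mul_assoc]
    gcongr
    exact norm_inner_le_norm (𝕜 := ℝ) u x
  calc _ ≤ 2 * Real.pi * (2 * Real.pi)⁻¹ := by gcongr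
    _ = 1 := mul_inv_cancel₀ (by positivity)

theorem fourierChar_scaledInner (u x : E) :
    (Real.fourierChar (-scaledInner E u x) : ℂ) = Complex.exp (-(Complex.I * (inner ℝ u x : ℝ))) := by
  rw [Real.fourierChar_apply, scaledInner_apply]
  congr 1
  have : (Real.pi : ℂ) ≠ 0 := by exact_mod_cast Real.pi_ne_zero
  push_cast
  field_simp

theorem norm_smulRight_innerC_le (h : E) : ‖(innerSL ℝ h).smulRight (innerC h)‖ ≤ ‖h‖ ^ 2 := by
  rw [ContinuousLinearMap.norm_smulRight_apply, pow_two]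
  gcongr
  · exact (innerSL_apply_norm ℝ h).le
  · exact norm_innerC_le h

theorem continuous_smulRight_innerC :
    Continuous fun h : E => (innerSL ℝ h).smulRight (innerC h) :=
  (ContinuousLinearMap.smulRightL ℝ E (E →L[ℝ] ℂ)).continuous₂.comp
    ((innerSL ℝ).continuous.prodMk continuous_innerC)

/-- The integrand of the second derivative of `compensated k`, before the Fourier transform. -/
noncomputable def hessWeight (k : E → ℝ) (h : E) : E →L[ℝ] E →L[ℝ] ℂ :=
  (-(k h : ℂ)) • (innerSL ℝ h).smulRight (innerC h)

theorem norm_hessWeight_le (k : E → ℝ) (h : E) : ‖hessWeight k h‖ ≤ ‖h‖ ^ 2 * |k h| := by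
  rw [hessWeight, norm_smul, norm_neg, Complex.norm_real, Real.norm_eq_abs, mul_comm]
  gcongr
  exact norm_smulRight_innerC_le h

theorem aestronglyMeasurable_hessWeight (hkm : Measurable k) :
    AEStronglyMeasurable (hessWeight k) (volume : Measure E) :=
  AEStronglyMeasurable.smul (Complex.measurable_ofReal.comp hkm).neg.aestronglyMeasurable
    continuous_smulRight_innerC.aestronglyMeasurable

/-- The second differentiation removes the remaining compensator, leaving a pure Fourier kernel
times `hessWeight k`. The form is `-scaledInner` because the exponent here is `+i⟨u, h⟩`; the sign
in `hessWeight` is `i² = -1`. -/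
theorem hasFDerivAt_compensated_deriv (h u : E) :
    HasFDerivAt (fun u : E => (Complex.I * (Complex.exp (Complex.I * (inner ℝ u h : ℝ)) - 1)
      * (k h : ℂ)) • innerC h) (Real.fourierChar (-(-scaledInner E) h u) • hessWeight k h) u := by
  have := (((((hasFDerivAt_exp_inner h u).sub_const 1).const_mul Complex.I).mul_const
    (k h : ℂ)).smul_const (innerC h))
  refine this.congr_fderiv ?_
  have he : (Real.fourierChar (-(-scaledInner E) h u) : ℂ)
      = Complex.exp (Complex.I * (inner ℝ u h : ℝ)) := by
    have := fourierChar_scaledInner (-h) u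
    simp only [map_neg, inner_neg_left] at this
    rw [real_inner_comm]
    simpa using this
  rw [Circle.smul_def, he]
  ext w w'
  simp only [hessWeight, ContinuousLinearMap.smulRight_apply, smul_apply,
    smul_eq_mul, innerC_apply, innerSL_apply_apply, Complex.real_smul, real_inner_comm w h]
  linear_combination (Complex.exp (Complex.I * (inner ℝ u h : ℝ)) * (inner ℝ w h : ℝ) * (k h : ℂ)
    * (inner ℝ w' h : ℝ)) * Complex.I_mul_I

theorem hasFDerivAt_fderiv_compensated (hkm : Measurable k)
    (hk : Integrable fun h => ‖h‖ ^ 2 * |k h|) (u : E) :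
    HasFDerivAt (fderiv ℝ (compensated k))
      (VectorFourier.fourierIntegral Real.fourierChar volume (-scaledInner E).toLinearMap₁₂
        (hessWeight k) u) u := by
  have hfd : fderiv ℝ (compensated k) = fun u =>
      ∫ h, (Complex.I * (Complex.exp (Complex.I * (inner ℝ u h : ℝ)) - 1) * (k h : ℂ)) •
        innerC h := funext fun u => (hasFDerivAt_compensated hkm hk u).fderiv
  have hmeas : ∀ v : E, AEStronglyMeasurable (fun h : E => (Complex.I *
      (Complex.exp (Complex.I * (inner ℝ v h : ℝ)) - 1) * (k h : ℂ)) • innerC h) volume := fun v =>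
    AEStronglyMeasurable.smul (measurable_compensated_deriv hkm _).aestronglyMeasurable
      continuous_innerC.aestronglyMeasurable
  have key : HasFDerivAt (fun u => ∫ h, (Complex.I *
      (Complex.exp (Complex.I * (inner ℝ u h : ℝ)) - 1) * (k h : ℂ)) • innerC h)
      (∫ h, Real.fourierChar (-(-scaledInner E) h u) • hessWeight k h) u := by
    refine hasFDerivAt_integral_of_dominated_of_fderiv_le (Metric.ball_mem_nhds u one_pos)
      (F' := fun u h => Real.fourierChar (-(-scaledInner E) h u) • hessWeight k h)
      (bound := fun h => ‖h‖ ^ 2 * |k h|)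
      (Eventually.of_forall hmeas) ?_ ?_ ?_ hk ?_
    · refine (hk.const_mul ‖u‖).mono' (hmeas u) (Eventually.of_forall fun h => ?_)
      rw [norm_smul, norm_mul, norm_mul, Complex.norm_I, one_mul, Complex.norm_real,
        Real.norm_eq_abs]
      calc _ ≤ (‖u‖ * ‖h‖) * |k h| * ‖h‖ := by
            gcongr
            · exact norm_exp_I_inner_sub_one_le u h
            · exact norm_innerC_le h
        _ = _ := by ring
    · refine AEStronglyMeasurable.smul (Continuous.aestronglyMeasurable ?_)
        (aestronglyMeasurable_hessWeight hkm)
      exact continuous_subtype_val.comp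
        (Real.continuous_fourierChar.comp ((-scaledInner E).flip u).continuous.neg)
    · refine Eventually.of_forall fun h v _ => ?_
      rw [Circle.norm_smul]
      exact norm_hessWeight_le k h
    · exact Eventually.of_forall fun h v _ => hasFDerivAt_compensated_deriv h v
  rw [hfd]
  exact key

theorem integrable_pow_norm_mul_hessWeight (hkm : Measurable k)
    (hk : Integrable fun h => ‖h‖ ^ 2 * |k h|) (hsupp : ∀ h, 1 < ‖h‖ → k h = 0) (n : ℕ) :
    Integrable fun h => ‖h‖ ^ n * ‖hessWeight k h‖ := by
  refine hk.mono' ((continuous_norm.pow n).aestronglyMeasurable.mul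
    (aestronglyMeasurable_hessWeight hkm).norm) (Eventually.of_forall fun h => ?_)
  rw [Real.norm_of_nonneg (by positivity)]
  rcases le_or_gt ‖h‖ 1 with h1 | h1
  · calc _ ≤ 1 * (‖h‖ ^ 2 * |k h|) := by
          gcongr
          · exact pow_le_one₀ (norm_nonneg _) h1
          · exact norm_hessWeight_le k h
      _ = _ := one_mul _
  · simp [hessWeight, hsupp h h1]

theorem fderiv_fderiv_compensated (hkm : Measurable k)
    (hk : Integrable fun h => ‖h‖ ^ 2 * |k h|) :
    fderiv ℝ (fderiv ℝ (compensated k)) =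
      VectorFourier.fourierIntegral Real.fourierChar volume (-scaledInner E).toLinearMap₁₂
        (hessWeight k) :=
  funext fun u => (hasFDerivAt_fderiv_compensated hkm hk u).fderiv

/-- The first two derivatives are taken by hand, since `k` itself need not be integrable. After that
the function is a Fourier transform of a weight with all moments finite, by bounded support. -/
theorem contDiff_compensated (hkm : Measurable k)
    (hk : Integrable fun h => ‖h‖ ^ 2 * |k h|) (hsupp : ∀ h, 1 < ‖h‖ → k h = 0) :
    ContDiff ℝ (⊤ : ℕ∞) (compensated k) := by
  rw [contDiff_infty_iff_fderiv]
  refine ⟨fun u => (hasFDerivAt_compensated hkm hk u).differentiableAt, ?_⟩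
  rw [contDiff_infty_iff_fderiv]
  refine ⟨fun u => (hasFDerivAt_fderiv_compensated hkm hk u).differentiableAt, ?_⟩
  rw [fderiv_fderiv_compensated hkm hk]
  exact VectorFourier.contDiff_fourierIntegral _ fun n _ =>
    integrable_pow_norm_mul_hessWeight hkm hk hsupp n

/-- Each derivative beyond the second brings down a factor of size at most `|h| ≤ 1` on the support,
so one bound serves every order and every `u`. -/
theorem norm_iteratedFDeriv_compensated_le (hkm : Measurable k)
    (hk : Integrable fun h => ‖h‖ ^ 2 * |k h|) (hsupp : ∀ h, 1 < ‖h‖ → k h = 0) (n : ℕ) (u : E) :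
    ‖iteratedFDeriv ℝ (n + 2) (compensated k) u‖ ≤ ∫ h, ‖h‖ ^ 2 * |k h| := by
  rw [← norm_iteratedFDeriv_fderiv, ← norm_iteratedFDeriv_fderiv,
    fderiv_fderiv_compensated hkm hk, VectorFourier.iteratedFDeriv_fourierIntegral _ (N := ⊤)
      (fun n _ => integrable_pow_norm_mul_hessWeight hkm hk hsupp n)
      (aestronglyMeasurable_hessWeight hkm) le_top]
  refine (VectorFourier.norm_fourierIntegral_le_integral_norm _ _ _ _ _).trans ?_
  refine integral_mono_of_nonneg (Eventually.of_forall fun h => norm_nonneg _) hk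
    (Eventually.of_forall fun h => ?_)
  refine (VectorFourier.norm_fourierPowSMulRight_le _ _ _ _).trans ?_
  rw [norm_neg]
  rcases le_or_gt ‖h‖ 1 with h1 | h1
  · calc _ ≤ 1 * 1 * (‖h‖ ^ 2 * |k h|) := by
          gcongr
          · exact pow_le_one₀ (by positivity) norm_scaledInner_le
          · exact pow_le_one₀ (norm_nonneg _) h1
          · exact norm_hessWeight_le k h
      _ = _ := by ring
  · simp [hessWeight, hsupp h h1]

theorem norm_fderiv_compensated_le (hkm : Measurable k)
    (hk : Integrable fun h => ‖h‖ ^ 2 * |k h|) (u : E) :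
    ‖fderiv ℝ (compensated k) u‖ ≤ (∫ h, ‖h‖ ^ 2 * |k h|) * ‖u‖ := by
  rw [(hasFDerivAt_compensated hkm hk u).fderiv, ← integral_mul_const]
  refine norm_integral_le_of_norm_le (hk.mul_const _) (Eventually.of_forall fun h => ?_)
  rw [norm_smul, norm_mul, norm_mul, Complex.norm_I, one_mul, Complex.norm_real,
    Real.norm_eq_abs]
  calc _ ≤ (‖u‖ * ‖h‖) * |k h| * ‖h‖ := by
        gcongr
        · exact norm_exp_I_inner_sub_one_le u h
        · exact norm_innerC_le h
    _ = _ := by ring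

end Compensated

/-! ### The characteristic function of the small jumps -/

/-- Induction on the order: the real derivative of `exp` is `exp` followed by the multiplication
map, which has norm at most 1. -/
theorem norm_iteratedFDeriv_cexp_le (n : ℕ) (z : ℂ) :
    ‖iteratedFDeriv ℝ n Complex.exp z‖ ≤ ‖Complex.exp z‖ := by
  induction n with
  | zero => simp
  | succ n ih =>
    have hfd : fderiv ℝ Complex.exp = ContinuousLinearMap.mul ℝ ℂ ∘ Complex.exp := by
      ext1 w
      rw [((Complex.hasDerivAt_exp w).hasFDerivAt.restrictScalars ℝ).fderiv]
      ext v
      simp [mul_comm]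
    rw [← norm_iteratedFDeriv_fderiv, hfd]
    refine ((ContinuousLinearMap.mul ℝ ℂ).norm_iteratedFDeriv_comp_left
      (N := ⊤) Complex.contDiff_exp.contDiffAt le_top).trans ?_
    calc _ ≤ 1 * ‖Complex.exp z‖ := by
          gcongr
          exact ContinuousLinearMap.opNorm_mul_le ℝ ℂ
      _ = _ := one_mul _

/-- A nonnegative weight on the unit ball with second moment at most `M`, bounded below by
`κ₀ |h|^(-d-α)`. -/
structure IsLocalWeight (α κ₀ M : ℝ) (k : E → ℝ) : Prop where
  measurable : Measurable k
  nonneg : ∀ h, 0 ≤ k h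
  integrable : Integrable fun h => ‖h‖ ^ 2 * |k h|
  moment_le : ∫ h, ‖h‖ ^ 2 * |k h| ≤ M
  support : ∀ h, 1 < ‖h‖ → k h = 0
  lower : ∀ h, h ≠ 0 → ‖h‖ ≤ 1 → κ₀ / ‖h‖ ^ ((finrank ℝ E : ℝ) + α) ≤ k h

/-- The characteristic function of the compensated jumps with weight `k`, with drift `b`. -/
noncomputable def localCharFun (k : E → ℝ) (b u : E) : ℂ :=
  Complex.exp (compensated k u + Complex.I * (inner ℝ u b : ℝ))

theorem norm_localCharFun (k : E → ℝ) (b u : E) :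
    ‖localCharFun k b u‖ = Real.exp (compensated k u).re := by
  simp [localCharFun, Complex.norm_exp]

namespace IsLocalWeight

variable {α κ₀ M : ℝ} {k : E → ℝ}

theorem bound_nonneg (hk : IsLocalWeight α κ₀ M k) : 0 ≤ M :=
  (integral_nonneg fun h => by positivity).trans hk.moment_le

theorem contDiff_exponent (hk : IsLocalWeight α κ₀ M k) (b : E) :
    ContDiff ℝ (⊤ : ℕ∞) fun u : E => compensated k u + Complex.I * (inner ℝ u b : ℝ) := by
  refine (contDiff_compensated hk.measurable hk.integrable hk.support).add
    (contDiff_const.mul ?_)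
  simpa only [← innerC_apply] using (innerC b).contDiff

theorem contDiff_localCharFun (hk : IsLocalWeight α κ₀ M k) (b : E) :
    ContDiff ℝ (⊤ : ℕ∞) (localCharFun k b) :=
  (hk.contDiff_exponent b).cexp

/-- The shape `D ^ n` is what the composition estimate for `exp` requires. Order 1 grows linearly in
`u`; from order 2 on the drift disappears and the bound `M` is absorbed because `D ≥ 1`. -/
theorem norm_iteratedFDeriv_exponent_le (hk : IsLocalWeight α κ₀ M k) {B : ℝ} {b : E}
    (hb : ‖b‖ ≤ B) (u : E) {n : ℕ} (hn : 1 ≤ n) :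
    ‖iteratedFDeriv ℝ n (fun u : E => compensated k u + Complex.I * (inner ℝ u b : ℝ)) u‖
      ≤ ((1 + M + B) * (1 + ‖u‖)) ^ n := by
  have hM := hk.bound_nonneg
  have hB : 0 ≤ B := (norm_nonneg b).trans hb
  have hD : 1 + M + B ≤ (1 + M + B) * (1 + ‖u‖) :=
    le_mul_of_one_le_right (by positivity) (by linarith [norm_nonneg u])
  have hlin : ∀ u : E, HasFDerivAt (fun u : E => Complex.I * ((inner ℝ u b : ℝ) : ℂ))
      (Complex.I • innerC b) u := fun u => (hasFDerivAt_innerC b u).const_mul _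
  have hfd : fderiv ℝ (fun u : E => compensated k u + Complex.I * (inner ℝ u b : ℝ))
      = fun u => fderiv ℝ (compensated k) u + Complex.I • innerC b := by
    ext1 u
    exact (((hasFDerivAt_compensated hk.measurable hk.integrable u).differentiableAt.hasFDerivAt).add
      (hlin u)).fderiv
  obtain ⟨m, rfl⟩ : ∃ m, n = m + 1 := ⟨n - 1, by omega⟩
  rw [← norm_iteratedFDeriv_fderiv, hfd]
  rcases m with _ | m
  · simp only [norm_iteratedFDeriv_zero, zero_add, pow_one]
    calc _ ≤ ‖fderiv ℝ (compensated k) u‖ + ‖Complex.I • innerC b‖ := norm_add_le _ _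
      _ ≤ M * ‖u‖ + B := by
        gcongr
        · exact (norm_fderiv_compensated_le hk.measurable hk.integrable u).trans
            (by gcongr; exact hk.moment_le)
        · rw [norm_smul, Complex.norm_I, one_mul]
          exact (norm_innerC_le b).trans hb
      _ ≤ _ := by nlinarith [norm_nonneg u, mul_nonneg hB (norm_nonneg u)]
  · have : fderiv ℝ (fun u => fderiv ℝ (compensated k) u + Complex.I • innerC b)
        = fderiv ℝ (fderiv ℝ (compensated k)) := by
      ext1 u; exact fderiv_add_const _
    rw [← norm_iteratedFDeriv_fderiv, this, norm_iteratedFDeriv_fderiv, norm_iteratedFDeriv_fderiv]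
    calc _ ≤ M := (norm_iteratedFDeriv_compensated_le hk.measurable hk.integrable hk.support
          m u).trans hk.moment_le
      _ ≤ 1 + M + B := by linarith
      _ ≤ (1 + M + B) * (1 + ‖u‖) := hD
      _ ≤ _ := le_self_pow₀ (by linarith) (by omega)

theorem norm_iteratedFDeriv_localCharFun_le (hk : IsLocalWeight α κ₀ M k) {B : ℝ} {b : E}
    (hb : ‖b‖ ≤ B) (u : E) (n : ℕ) :
    ‖iteratedFDeriv ℝ n (localCharFun k b) u‖
      ≤ n.factorial * ‖localCharFun k b u‖ * ((1 + M + B) * (1 + ‖u‖)) ^ n :=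
  norm_iteratedFDeriv_comp_le (N := (⊤ : ℕ∞)) (g := Complex.exp) Complex.contDiff_exp
    (hk.contDiff_exponent b) (mod_cast le_top) u
    (fun i _ => norm_iteratedFDeriv_cexp_le i _)
    (fun _ hi _ => hk.norm_iteratedFDeriv_exponent_le hb u hi)

theorem re_compensated (hk : IsLocalWeight α κ₀ M k) (u : E) :
    (compensated k u).re = -∫ h, (1 - Real.cos (inner ℝ u h)) * k h := by
  have := integral_re (integrable_compensated hk.measurable hk.integrable u)
  rw [compensated, ← integral_neg]
  refine this.symm.trans (integral_congr_ae (Eventually.of_forall fun h => ?_))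
  simp [mul_comm Complex.I, Complex.exp_ofReal_mul_I_re]
  ring

theorem integrable_one_sub_cos (hk : IsLocalWeight α κ₀ M k) (u : E) :
    Integrable fun h => (1 - Real.cos (inner ℝ u h)) * k h := by
  refine (integrable_compensated hk.measurable hk.integrable u).re.neg.congr
    (Eventually.of_forall fun h => ?_)
  simp [mul_comm Complex.I, Complex.exp_ofReal_mul_I_re]
  ring

theorem re_compensated_nonpos (hk : IsLocalWeight α κ₀ M k) (u : E) :
    (compensated k u).re ≤ 0 := by
  rw [hk.re_compensated, neg_nonpos]
  exact integral_nonneg fun h => mul_nonneg (by linarith [Real.cos_le_one (inner ℝ u h)])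
    (hk.nonneg h)

/-- It suffices to integrate over one ball of radius `1 / (4|u|)` around `u / (2|u|²)`. There `⟨u,
h⟩` lies between 1/4 and 3/4 and `|h| ≤ 1/|u|`, so the integrand is at least a constant times `|u| ^
(d + α)`, while the volume is of order `|u| ^ (-d)`. -/
theorem re_compensated_le (hk : IsLocalWeight α κ₀ M k) (hκ : 0 ≤ κ₀) (hα : 0 < α) {u : E}
    (hu : 1 ≤ ‖u‖) :
    (compensated k u).re ≤ -(κ₀ * (volume : Measure E).real (Metric.ball 0 1) /
      (80 * 4 ^ finrank ℝ E) * ‖u‖ ^ α) := by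
  have hu0 : 0 < ‖u‖ := by linarith
  rw [hk.re_compensated, neg_le_neg_iff]
  set x : E := (2 * ‖u‖ ^ 2)⁻¹ • u with hx
  set S := Metric.ball x (1 / (4 * ‖u‖)) with hS
  have hxn : ‖x‖ = 1 / (2 * ‖u‖) := by
    rw [hx, norm_smul, Real.norm_of_nonneg (by positivity)]
    field_simp
  have hxi : inner ℝ u x = 1 / 2 := by
    rw [hx, inner_smul_right, real_inner_self_eq_norm_sq]
    field_simp
  have hvol : (volume : Measure E).real S
      = (1 / (4 * ‖u‖)) ^ finrank ℝ E * (volume : Measure E).real (Metric.ball 0 1) := by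
    rw [hS, Measure.real, Measure.addHaar_ball_of_pos _ _ (by positivity), ENNReal.toReal_mul,
      ENNReal.toReal_ofReal (by positivity), Measure.real]
  have hpt : ∀ h ∈ S, 1 / 80 * (κ₀ * ‖u‖ ^ ((finrank ℝ E : ℝ) + α))
      ≤ (1 - Real.cos (inner ℝ u h)) * k h := by
    intro h hh
    have hhx : ‖h - x‖ < 1 / (4 * ‖u‖) := mem_ball_iff_norm.1 hh
    have hi : |inner ℝ u h - 1 / 2| ≤ 1 / 4 := by
      rw [← hxi, ← inner_sub_right]
      calc _ ≤ ‖u‖ * ‖h - x‖ := abs_real_inner_le_norm _ _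
        _ ≤ ‖u‖ * (1 / (4 * ‖u‖)) := by gcongr
        _ = 1 / 4 := by field_simp
    obtain ⟨hi1, hi2⟩ := abs_le.1 hi
    have hn : ‖h‖ ≤ 1 / ‖u‖ := by
      calc ‖h‖ ≤ ‖x‖ + ‖h - x‖ := norm_le_norm_add_norm_sub' h x
        _ ≤ 1 / (2 * ‖u‖) + 1 / (4 * ‖u‖) := by rw [hxn]; gcongr
        _ = 3 / 4 * (1 / ‖u‖) := by field_simp; norm_num
        _ ≤ 1 / ‖u‖ := by
          have : 0 < 1 / ‖u‖ := by positivity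
          linarith
    have hn1 : ‖h‖ ≤ 1 := hn.trans (by rw [div_le_one hu0]; exact hu)
    have hne : h ≠ 0 := by
      rintro rfl
      rw [inner_zero_right] at hi1
      linarith
    -- From `1 - cos y ≥ (2/π²) y²` with `π² < 10` and `y ≥ 1/4`: `1/5 * 1/16 = 1/80`.
    have hcos : 1 / 80 ≤ 1 - Real.cos (inner ℝ u h) := by
      have h1 := Real.cos_le_one_sub_mul_cos_sq (x := inner ℝ u h)
        (abs_le.2 ⟨by linarith [Real.pi_gt_three], by linarith [Real.pi_gt_three]⟩)
      have h2 : 1 / 5 ≤ 2 / Real.pi ^ 2 := by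
        rw [div_le_div_iff₀ (by norm_num) (by positivity)]
        nlinarith [Real.pi_lt_d2, Real.pi_gt_three]
      have h3 : (1 / 4 : ℝ) ^ 2 ≤ (inner ℝ u h) ^ 2 :=
        pow_le_pow_left₀ (by norm_num) (by linarith) 2
      have h4 : 1 / 5 * (1 / 4 : ℝ) ^ 2 ≤ 2 / Real.pi ^ 2 * (inner ℝ u h) ^ 2 := by gcongr
      linarith
    have hpos : 0 < ‖h‖ := norm_pos_iff.2 hne
    have hd0 : (0 : ℝ) ≤ finrank ℝ E := Nat.cast_nonneg _
    refine mul_le_mul hcos (le_trans ?_ (hk.lower h hne hn1)) (by positivity) (by linarith)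
    rw [div_eq_mul_inv, ← Real.inv_rpow hpos.le]
    gcongr
    rw [le_inv_comm₀ hu0 hpos]
    simpa using hn
  calc _ = ∫ h in S, 1 / 80 * (κ₀ * ‖u‖ ^ ((finrank ℝ E : ℝ) + α)) := by
        rw [setIntegral_const, hvol, Real.rpow_add hu0, Real.rpow_natCast, smul_eq_mul, one_div_pow,
          mul_pow]
        field_simp
    _ ≤ ∫ h in S, (1 - Real.cos (inner ℝ u h)) * k h := by
        refine setIntegral_mono_on ?_ (hk.integrable_one_sub_cos u).integrableOn
          measurableSet_ball hpt
        exact integrableOn_const measure_ball_lt_top.ne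
    _ ≤ _ := by
        refine setIntegral_le_integral (hk.integrable_one_sub_cos u)
          (Eventually.of_forall fun h => mul_nonneg ?_ (hk.nonneg h))
        linarith [Real.cos_le_one (inner ℝ u h)]

end IsLocalWeight

/-- Keep a single term of the exponential series, of order `n` with `n α ≥ m`. -/
theorem exists_exp_neg_mul_rpow_le {c α : ℝ} (hc : 0 < c) (hα : 0 < α) (m : ℕ) :
    ∃ C : ℝ, 0 < C ∧ ∀ x : ℝ, 1 ≤ x → Real.exp (-(c * x ^ α)) ≤ C * ((1 + x) ^ m)⁻¹ := by
  obtain ⟨n, hn⟩ := exists_nat_ge ((m : ℝ) / α)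
  rw [div_le_iff₀ hα] at hn
  refine ⟨n.factorial / c ^ n * 2 ^ m, by positivity, fun x hx => ?_⟩
  have hx0 : 0 < x := by linarith
  have h1 := Real.pow_div_factorial_le_exp (c * x ^ α) (by positivity) n
  have h2 : x ^ m ≤ (x ^ α) ^ n := by
    rw [← Real.rpow_natCast, ← Real.rpow_natCast, ← Real.rpow_mul hx0.le]
    exact Real.rpow_le_rpow_of_exponent_le hx (by linarith)
  have h3 : (1 + x) ^ m ≤ 2 ^ m * (x ^ α) ^ n := by
    calc (1 + x) ^ m ≤ (2 * x) ^ m := by gcongr; linarith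
      _ = 2 ^ m * x ^ m := mul_pow _ _ _
      _ ≤ _ := by gcongr
  rw [Real.exp_neg, ← div_eq_mul_inv, le_div_iff₀ (by positivity)]
  rw [mul_pow, div_le_iff₀ (by positivity)] at h1
  rw [inv_mul_le_iff₀ (Real.exp_pos _)]
  calc (1 + x) ^ m ≤ 2 ^ m * (x ^ α) ^ n := h3
    _ = 2 ^ m * (c ^ n * (x ^ α) ^ n) / c ^ n := by field_simp
    _ ≤ 2 ^ m * (Real.exp (c * x ^ α) * n.factorial) / c ^ n := by gcongr
    _ = _ := by ring

/-- The modulus depends only on the real part of the exponent, which the drift does not affect;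
hence the constant is uniform in `b`, `M` and `k`. -/
theorem exists_norm_localCharFun_le [Nontrivial E] {α κ₀ : ℝ} (hκ : 0 < κ₀) (hα : 0 < α) (m : ℕ) :
    ∃ C : ℝ, 0 < C ∧ ∀ (M : ℝ) (k : E → ℝ), IsLocalWeight α κ₀ M k → ∀ b u : E,
      ‖localCharFun k b u‖ ≤ C * ((1 + ‖u‖) ^ m)⁻¹ := by
  have hv : 0 < (volume : Measure E).real (Metric.ball 0 1) :=
    ENNReal.toReal_pos (Metric.measure_ball_pos _ _ one_pos).ne' measure_ball_lt_top.ne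
  obtain ⟨C, hC, hCle⟩ := exists_exp_neg_mul_rpow_le (c := κ₀ *
    (volume : Measure E).real (Metric.ball 0 1) / (80 * 4 ^ finrank ℝ E)) (by positivity) hα m
  refine ⟨max C (2 ^ m), by positivity, fun M k hk b u => ?_⟩
  rw [norm_localCharFun]
  rcases le_total 1 ‖u‖ with hu | hu
  · calc _ ≤ _ := Real.exp_le_exp.2 (hk.re_compensated_le hκ.le hα hu)
      _ ≤ _ := hCle _ hu
      _ ≤ _ := by gcongr; exact le_max_left _ _
  · calc _ ≤ (1 : ℝ) := Real.exp_le_one_iff.2 (hk.re_compensated_nonpos u)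
      _ ≤ 2 ^ m * ((1 + ‖u‖) ^ m)⁻¹ := by
        rw [← div_eq_mul_inv, one_le_div (by positivity)]
        gcongr
        linarith
      _ ≤ _ := by gcongr; exact le_max_right _ _

/-! ### Decay of the Fourier transform of the small-jump characteristic function -/

/-- The Fourier transform with the kernel `exp (-i ⟨u, x⟩)`. -/
noncomputable def fourierI (φ : E → ℂ) (x : E) : ℂ :=
  ∫ u, Complex.exp (-(Complex.I * (inner ℝ u x : ℝ))) * φ u

theorem fourierI_eq_fourierIntegral (φ : E → ℂ) :
    fourierI φ = VectorFourier.fourierIntegral Real.fourierChar volume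
      (scaledInner E).toLinearMap₁₂ φ := by
  ext x
  refine integral_congr_ae (Eventually.of_forall fun u => ?_)
  simp only [Circle.smul_def, smul_eq_mul]
  rw [← fourierChar_scaledInner]
  rfl

/-- The directional form turns a gradient estimate into an estimate for a scalar Fourier transform,
to which the convolution argument applies again. -/
theorem hasFDerivAt_fourierI {φ : E → ℂ} (hφ : Integrable φ)
    (hφ' : Integrable fun u => ‖u‖ * ‖φ u‖) (x : E) :
    HasFDerivAt (fourierI φ) (fderiv ℝ (fourierI φ) x) x ∧ ∀ e : E,
      fderiv ℝ (fourierI φ) x e = -Complex.I * fourierI (fun u => (inner ℝ u e : ℝ) * φ u) x := by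
  have h := VectorFourier.hasFDerivAt_fourierIntegral (scaledInner E) hφ hφ' x
  rw [← fourierI_eq_fourierIntegral] at h
  refine ⟨h.differentiableAt.hasFDerivAt, fun e => ?_⟩
  rw [h.fderiv, Real.fourierIntegral_continuousLinearMap_apply']
  · rw [← fourierI_eq_fourierIntegral, fourierI, fourierI, ← integral_const_mul]
    refine integral_congr_ae (Eventually.of_forall fun u => ?_)
    have : (Real.pi : ℂ) ≠ 0 := by exact_mod_cast Real.pi_ne_zero
    simp only [VectorFourier.fourierSMulRight_apply, scaledInner_apply, smul_eq_mul,
      Complex.real_smul]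
    push_cast
    field_simp
  · refine (hφ'.const_mul (2 * Real.pi * ‖scaledInner E‖)).mono' hφ.1.fourierSMulRight
      (Eventually.of_forall fun u => ?_)
    rw [← mul_assoc]
    exact VectorFourier.norm_fourierSMulRight_le _ _ _

theorem integrable_inv_one_add_norm_pow :
    Integrable fun u : E => ((1 + ‖u‖) ^ (finrank ℝ E + 1))⁻¹ := by
  have := integrable_one_add_norm (E := E) (μ := volume) (r := (finrank ℝ E + 1 : ℕ))
    (by exact_mod_cast Nat.lt_succ_self _)
  refine this.congr (Eventually.of_forall fun u => ?_)
  simp only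
  rw [Real.rpow_neg (by positivity), Real.rpow_natCast]

section Decay

variable {φ : E → ℂ} {N : ℕ} {A : ℝ}

/-- Symbol-type bound on the derivatives of `φ` up to order `N`, uniform in the order. -/
def HasFastDerivs (N : ℕ) (A : ℝ) (φ : E → ℂ) : Prop :=
  ContDiff ℝ N φ ∧ ∀ n ≤ N, ∀ p ≤ 1, ∀ u : E,
    ‖u‖ ^ p * ‖iteratedFDeriv ℝ n φ u‖ ≤ A * ((1 + ‖u‖) ^ (finrank ℝ E + 1))⁻¹

theorem HasFastDerivs.integrable (h : HasFastDerivs N A φ) {n p : ℕ} (hn : n ≤ N) (hp : p ≤ 1) :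
    Integrable fun u => ‖u‖ ^ p * ‖iteratedFDeriv ℝ n φ u‖ := by
  refine (integrable_inv_one_add_norm_pow.const_mul A).mono' ?_
    (Eventually.of_forall fun u => ?_)
  · exact ((continuous_norm.pow p).mul
      (h.1.continuous_iteratedFDeriv (mod_cast hn)).norm).aestronglyMeasurable
  · rw [Real.norm_of_nonneg (by positivity)]
    exact h.2 n hn p hp u

theorem HasFastDerivs.pow_mul_norm_iteratedFDeriv_fourierI_le (h : HasFastDerivs N A φ) {n j : ℕ}
    (hn : n ≤ N) (hj : j ≤ 1) (x : E) :
    ‖x‖ ^ n * ‖iteratedFDeriv ℝ j (fourierI φ) x‖ ≤ (8 * Real.pi) ^ n * (2 * (n + 1) *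
      (A * ∫ u : E, ((1 + ‖u‖) ^ (finrank ℝ E + 1))⁻¹)) := by
  set J := ∫ u : E, ((1 + ‖u‖) ^ (finrank ℝ E + 1))⁻¹
  have hA : 0 ≤ A := by
    have := (norm_nonneg _).trans ((one_mul _).symm.le.trans (h.2 0 (Nat.zero_le _) 0 zero_le_one 0))
    simpa using this
  have hJ : 0 ≤ J := integral_nonneg fun u => by positivity
  -- Both vector slots are taken to be `x`: the left side then carries `(|x|² / 2π) ^ n` against
  -- `|x| ^ n` on the right, and one power `|x| ^ n` cancels when `x ≠ 0`. The factor `(2j + 2) ^ n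
  -- ≤ 4 ^ n` combines with `(2π) ^ n` into `(8π) ^ n`.
  have key := VectorFourier.pow_mul_norm_iteratedFDeriv_fourierIntegral_le (scaledInner E)
    (μ := volume) (K := 1) (N := N) (f := φ) h.1
    (fun p n hp hn => h.integrable (by exact_mod_cast hn) (by exact_mod_cast hp))
    (k := j) (n := n) (by exact_mod_cast hj) (by exact_mod_cast hn) x x
  rw [← fourierI_eq_fourierIntegral] at key
  have hsum : ∑ p ∈ Finset.range (j + 1) ×ˢ Finset.range (n + 1),
      ∫ u, ‖u‖ ^ p.1 * ‖iteratedFDeriv ℝ p.2 φ u‖ ≤ 2 * (n + 1) * (A * J) := by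
    calc _ ≤ ∑ p ∈ Finset.range (j + 1) ×ˢ Finset.range (n + 1), A * J := by
          refine Finset.sum_le_sum fun p hp => ?_
          rw [Finset.mem_product, Finset.mem_range, Finset.mem_range] at hp
          rw [← integral_const_mul]
          exact integral_mono (h.integrable (by omega) (by omega))
            (integrable_inv_one_add_norm_pow.const_mul A) (h.2 _ (by omega) _ (by omega))
      _ = (j + 1) * (n + 1) * (A * J) := by simp
      _ ≤ (1 + 1) * (n + 1) * (A * J) := by gcongr; exact_mod_cast hj
      _ = _ := by ring
  have hL : |scaledInner E x x| = (2 * Real.pi)⁻¹ * ‖x‖ * ‖x‖ := by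
    rw [scaledInner_apply, real_inner_self_eq_norm_sq, abs_of_nonneg (by positivity)]; ring
  rw [hL] at key
  have key2 : (2 * Real.pi)⁻¹ ^ n * ‖x‖ ^ n * ‖x‖ ^ n * ‖iteratedFDeriv ℝ j (fourierI φ) x‖
      ≤ ‖x‖ ^ n * (1 * (4 ^ n * (2 * (n + 1) * (A * J)))) := by
    rw [← mul_pow, ← mul_pow]
    refine key.trans ?_
    rw [mul_assoc, mul_assoc]
    gcongr
    · exact pow_le_one₀ (by positivity) norm_scaledInner_le
    · have : (j : ℝ) ≤ 1 := by exact_mod_cast hj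
      linarith
  rcases eq_or_ne x 0 with rfl | hx
  · rcases n with _ | n
    · simpa using key2
    · simp only [norm_zero, ne_eq, Nat.add_eq_zero_iff, one_ne_zero, and_false, not_false_eq_true,
        zero_pow, zero_mul]
      positivity
  · have hx0 : 0 < ‖x‖ ^ n := pow_pos (norm_pos_iff.2 hx) n
    have key3 : (2 * Real.pi)⁻¹ ^ n * (‖x‖ ^ n * ‖iteratedFDeriv ℝ j (fourierI φ) x‖)
        ≤ 4 ^ n * (2 * (n + 1) * (A * J)) := by
      refine le_of_mul_le_mul_left ?_ hx0
      calc _ = _ := by ring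
        _ ≤ _ := key2
        _ = _ := by ring
    rw [inv_pow, inv_mul_le_iff₀ (by positivity)] at key3
    calc _ ≤ _ := key3
      _ = _ := by rw [← mul_assoc, ← mul_pow]; ring_nf

theorem exists_fourierI_decay (N : ℕ) (A : ℝ) (hA : 0 < A) :
    ∃ C : ℝ, 0 < C ∧ ∀ φ : E → ℂ, HasFastDerivs N A φ → ∀ j ≤ 1, ∀ x : E,
      ‖iteratedFDeriv ℝ j (fourierI φ) x‖ ≤ C * ((1 + ‖x‖) ^ N)⁻¹ := by
  set J := ∫ u : E, ((1 + ‖u‖) ^ (finrank ℝ E + 1))⁻¹ with hJdef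
  have hJ : 0 ≤ J := integral_nonneg fun u => by positivity
  -- The two summands are the weighted bounds with powers `N` and 0; the final `+ 1` gives
  -- positivity from `0 ≤ J` alone.
  refine ⟨2 ^ N * ((8 * Real.pi) ^ N * (2 * (N + 1) * (A * J)) + (2 * (A * J))) + 1,
    by positivity, fun φ hφ j hj x => ?_⟩
  rw [← div_eq_mul_inv, le_div_iff₀ (by positivity)]
  have h1 : (1 + ‖x‖) ^ N ≤ 2 ^ N * (‖x‖ ^ N + 1) := by
    rcases le_total ‖x‖ 1 with h | h
    · calc (1 + ‖x‖) ^ N ≤ 2 ^ N * 1 := by rw [mul_one]; gcongr; linarith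
        _ ≤ _ := by gcongr; linarith [pow_nonneg (norm_nonneg x) N]
    · calc (1 + ‖x‖) ^ N ≤ (2 * ‖x‖) ^ N := by gcongr; linarith
        _ = 2 ^ N * ‖x‖ ^ N := mul_pow _ _ _
        _ ≤ _ := by gcongr; linarith
  have h2 := hφ.pow_mul_norm_iteratedFDeriv_fourierI_le le_rfl hj x
  have h3 := hφ.pow_mul_norm_iteratedFDeriv_fourierI_le (Nat.zero_le N) hj x
  simp only [pow_zero, one_mul, Nat.cast_zero, zero_add, mul_one] at h3
  calc _ ≤ ‖iteratedFDeriv ℝ j (fourierI φ) x‖ * (2 ^ N * (‖x‖ ^ N + 1)) := by gcongr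
    _ = 2 ^ N * (‖x‖ ^ N * ‖iteratedFDeriv ℝ j (fourierI φ) x‖
        + ‖iteratedFDeriv ℝ j (fourierI φ) x‖) := by ring
    _ ≤ 2 ^ N * ((8 * Real.pi) ^ N * (2 * (N + 1) * (A * J)) + (2 * (A * J))) := by gcongr
    _ ≤ _ := by linarith

end Decay

theorem exists_hasFastDerivs_localCharFun [Nontrivial E] {α κ₀ : ℝ} (hκ : 0 < κ₀) (hα : 0 < α)
    {M B : ℝ} (hM : 0 ≤ M) (hB : 0 ≤ B) (N : ℕ) :
    ∃ A : ℝ, 0 < A ∧ ∀ (k : E → ℝ) (b : E), IsLocalWeight α κ₀ M k → ‖b‖ ≤ B →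
      HasFastDerivs N A (localCharFun k b) := by
  -- Of the decay order, `N` powers pay for the growth of the derivatives, one for the weight `‖u‖ ^
  -- p`, and `finrank ℝ E + 1` remain for integrability.
  obtain ⟨C, hC, hle⟩ := exists_norm_localCharFun_le (E := E) hκ hα (finrank ℝ E + 1 + (N + 1))
  refine ⟨N.factorial * C * (1 + M + B) ^ N, by positivity, fun k b hk hb =>
    ⟨(hk.contDiff_localCharFun b).of_le (by exact_mod_cast le_top), fun n hn p hp u => ?_⟩⟩
  have hu : 1 ≤ 1 + ‖u‖ := by linarith [norm_nonneg u]
  calc _ ≤ (1 + ‖u‖) ^ 1 * (N.factorial * (C * ((1 + ‖u‖) ^ (finrank ℝ E + 1 + (N + 1)))⁻¹)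
        * ((1 + M + B) ^ N * (1 + ‖u‖) ^ N)) := by
        gcongr ?_ * ?_
        · exact (pow_le_pow_left₀ (norm_nonneg u) (by linarith) p).trans
            (pow_le_pow_right₀ hu hp)
        · refine (hk.norm_iteratedFDeriv_localCharFun_le hb u n).trans ?_
          rw [mul_pow]
          gcongr
          · exact hle M k hk b u
          · linarith
    _ = _ := by
        rw [pow_add (1 + ‖u‖) (finrank ℝ E + 1), pow_succ (1 + ‖u‖) N]
        field_simp

/-! ### Perturbation by a compound Poisson factor -/

/-- The profile `(1 + |x|)^(-s)`. -/
noncomputable def profile (s : ℝ) (x : E) : ℝ := (1 + ‖x‖) ^ (-s)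

theorem profile_pos (s : ℝ) (x : E) : 0 < profile s x :=
  Real.rpow_pos_of_pos (by positivity) _

theorem integrable_profile {s : ℝ} (hs : (finrank ℝ E : ℝ) < s) :
    Integrable (profile s : E → ℝ) :=
  integrable_one_add_norm hs

theorem profile_le_of_norm_le {s : ℝ} (hs : 0 ≤ s) {x y : E} (h : ‖x‖ ≤ 2 * ‖y‖) :
    profile s y ≤ 2 ^ s * profile s x := by
  have : (2 : ℝ) ^ s * profile s x = ((1 + ‖x‖) / 2) ^ (-s) := by
    rw [Real.div_rpow (by positivity) zero_le_two, Real.rpow_neg zero_le_two, div_inv_eq_mul,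
      mul_comm, profile]
  rw [this]
  exact Real.rpow_le_rpow_of_nonpos (by positivity) (by linarith) (by linarith)

/-- One of `|x - h|`, `|h|` is at least `|x| / 2`, so the corresponding factor is at most `2 ^ s`
times the profile at `x`. After integration the profile is stable under convolution with itself. -/
theorem profile_sub_mul_profile_le {s : ℝ} (hs : 0 ≤ s) (x h : E) :
    profile s (x - h) * profile s h ≤ 2 ^ s * profile s x * (profile s (x - h) + profile s h) := by
  have hx : ‖x‖ ≤ ‖x - h‖ + ‖h‖ := by simpa using norm_add_le (x - h) h
  have h1 := profile_pos s (x - h)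
  have h2 := profile_pos s h
  have h3 : 0 < 2 ^ s * profile s x := mul_pos (by positivity) (profile_pos s x)
  rcases le_total ‖h‖ ‖x - h‖ with hle | hle
  · have := profile_le_of_norm_le hs (x := x) (y := x - h) (by linarith)
    nlinarith
  · have := profile_le_of_norm_le hs (x := x) (y := h) (by linarith)
    nlinarith

theorem integrable_profile_sub {s : ℝ} (hs : (finrank ℝ E : ℝ) < s) (x : E) :
    Integrable (fun h : E => profile s (x - h)) :=
  (integrable_profile hs).comp_sub_left x

theorem integral_profile_conv_le {s : ℝ} (hs : (finrank ℝ E : ℝ) < s) (x : E) :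
    Integrable (fun h : E => profile s (x - h) * profile s h) ∧
    ∫ h, profile s (x - h) * profile s h ≤ 2 ^ s * (2 * ∫ h : E, profile s h) * profile s x := by
  have hs0 : 0 ≤ s := (Nat.cast_nonneg _).trans hs.le
  have hi := ((integrable_profile_sub hs x).add (integrable_profile hs)).const_mul
    (2 ^ s * profile s x)
  have hnn : ∀ h : E, 0 ≤ profile s (x - h) * profile s h := fun h =>
    mul_nonneg (profile_pos _ _).le (profile_pos _ _).le
  have hint : Integrable (fun h : E => profile s (x - h) * profile s h) := by
    refine hi.mono' ?_ (Eventually.of_forall fun h => ?_)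
    · exact (integrable_profile_sub hs x).1.mul (integrable_profile hs).1
    · rw [Real.norm_of_nonneg (hnn h)]
      exact profile_sub_mul_profile_le hs0 x h
  refine ⟨hint, (integral_mono hint hi (profile_sub_mul_profile_le hs0 x)).trans_eq ?_⟩
  simp only [Pi.add_apply]
  rw [integral_const_mul, integral_add (integrable_profile_sub hs x) (integrable_profile hs),
    integral_sub_left_eq_self (fun h : E => profile s h)]
  ring

/-- The Fourier transform of the weight `q`, with the kernel `exp (i ⟨u, h⟩)`. -/
noncomputable def weightHat (q : E → ℝ) (u : E) : ℂ :=
  ∫ h, Complex.exp (Complex.I * (inner ℝ u h : ℝ)) * (q h : ℂ)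

/-- A nonnegative weight dominated by a multiple of the profile. -/
structure IsTailWeight (s κ : ℝ) (q : E → ℝ) : Prop where
  measurable : Measurable q
  nonneg : ∀ h, 0 ≤ q h
  le : ∀ h, q h ≤ κ * profile s h

namespace IsTailWeight

variable {s κ : ℝ} {q : E → ℝ}

theorem const_nonneg (hq : IsTailWeight s κ q) : 0 ≤ κ := by
  have := (hq.nonneg 0).trans (hq.le 0)
  exact nonneg_of_mul_nonneg_left this (profile_pos _ _)

theorem integrable (hq : IsTailWeight s κ q) (hs : (finrank ℝ E : ℝ) < s) : Integrable q :=
  ((integrable_profile hs).const_mul κ).mono' hq.measurable.aestronglyMeasurable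
    (Eventually.of_forall fun h => by rw [Real.norm_of_nonneg (hq.nonneg h)]; exact hq.le h)

theorem integrable_exp_mul (hq : IsTailWeight s κ q) (hs : (finrank ℝ E : ℝ) < s) (u : E) :
    Integrable fun h : E => Complex.exp (Complex.I * (inner ℝ u h : ℝ)) * (q h : ℂ) := by
  refine (hq.integrable hs).mono (by have := hq.measurable; fun_prop)
    (Eventually.of_forall fun h => ?_)
  rw [norm_mul, norm_exp_I_inner, one_mul, Complex.norm_real]

theorem norm_weightHat_le (hq : IsTailWeight s κ q) (u : E) :
    ‖weightHat q u‖ ≤ ∫ h, q h := by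
  refine (norm_integral_le_integral_norm _).trans_eq (integral_congr_ae
    (Eventually.of_forall fun h => ?_))
  simp only
  rw [norm_mul, norm_exp_I_inner, one_mul, Complex.norm_real, Real.norm_of_nonneg (hq.nonneg h)]

theorem continuous_weightHat (hq : IsTailWeight s κ q) (hs : (finrank ℝ E : ℝ) < s) :
    Continuous (weightHat q) := by
  refine continuous_of_dominated (bound := q) (fun u => (hq.integrable_exp_mul hs u).1)
    (fun u => Eventually.of_forall fun h => ?_) (hq.integrable hs)
    (Eventually.of_forall fun h => by fun_prop)
  rw [norm_mul, norm_exp_I_inner, one_mul, Complex.norm_real, Real.norm_of_nonneg (hq.nonneg h)]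

theorem integrable_mul_weightHat_pow (hq : IsTailWeight s κ q) (hs : (finrank ℝ E : ℝ) < s)
    {φ : E → ℂ} (hφ : Integrable φ) (n : ℕ) : Integrable fun u => φ u * weightHat q u ^ n := by
  refine hφ.mul_bdd (c := (∫ h, q h) ^ n)
    ((hq.continuous_weightHat hs).pow n).aestronglyMeasurable (Eventually.of_forall fun u => ?_)
  rw [norm_pow]
  gcongr
  exact hq.norm_weightHat_le u

/-- Fubini: a product on the Fourier side is a convolution in space. -/
theorem fourierI_mul_weightHat (hq : IsTailWeight s κ q) (hs : (finrank ℝ E : ℝ) < s)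
    {φ : E → ℂ} (hφ : Integrable φ) (x : E) :
    fourierI (fun u => φ u * weightHat q u) x = ∫ h, fourierI φ (x - h) * (q h : ℂ) := by
  have hprod : Integrable (Function.uncurry fun u h : E => Complex.exp (-(Complex.I *
      (inner ℝ u x : ℝ))) * φ u * (Complex.exp (Complex.I * (inner ℝ u h : ℝ)) * (q h : ℂ)))
      (volume.prod volume) := by
    refine (hφ.mul_prod ((hq.integrable hs).ofReal (𝕜 := ℂ))).mono ?_ (Eventually.of_forall fun p => ?_)
    · have h1 : AEStronglyMeasurable (fun p : E × E => φ p.1 * ((q p.2 : ℝ) : ℂ))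
          (volume.prod volume) := (hφ.mul_prod ((hq.integrable hs).ofReal (𝕜 := ℂ))).1
      have h2 : AEStronglyMeasurable (fun p : E × E => Complex.exp (-(Complex.I *
        (inner ℝ p.1 x : ℝ))) * Complex.exp (Complex.I * (inner ℝ p.1 p.2 : ℝ)))
          (volume.prod volume) := (by fun_prop : Continuous _).aestronglyMeasurable
      refine (h2.mul h1).congr (Eventually.of_forall fun p => ?_)
      simp only [Function.uncurry, Pi.mul_apply]
      ring
    · have h1 : ‖Complex.exp (-(Complex.I * (inner ℝ p.1 x : ℝ)))‖ = 1 := by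
        rw [← mul_neg, ← Complex.ofReal_neg, ← inner_neg_right, norm_exp_I_inner]
      simp only [Function.uncurry, norm_mul, h1, norm_exp_I_inner, one_mul]
      exact le_rfl
  calc fourierI (fun u => φ u * weightHat q u) x
      = ∫ u, ∫ h, Complex.exp (-(Complex.I * (inner ℝ u x : ℝ))) * φ u *
          (Complex.exp (Complex.I * (inner ℝ u h : ℝ)) * (q h : ℂ)) := by
        refine integral_congr_ae (Eventually.of_forall fun u => ?_)
        simp only [weightHat]
        rw [integral_const_mul, mul_assoc]
    _ = ∫ h, ∫ u, Complex.exp (-(Complex.I * (inner ℝ u x : ℝ))) * φ u *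
          (Complex.exp (Complex.I * (inner ℝ u h : ℝ)) * (q h : ℂ)) := integral_integral_swap hprod
    _ = _ := by
        refine integral_congr_ae (Eventually.of_forall fun h => ?_)
        simp only [fourierI]
        rw [← integral_mul_const]
        refine integral_congr_ae (Eventually.of_forall fun u => ?_)
        simp only [inner_sub_right, Complex.ofReal_sub, mul_sub, neg_sub, Complex.exp_sub,
          Complex.exp_neg]
        ring

theorem norm_fourierI_mul_weightHat_le (hq : IsTailWeight s κ q) (hs : (finrank ℝ E : ℝ) < s)
    {φ : E → ℂ} (hφ : Integrable φ) {A : ℝ} (hA : ∀ x, ‖fourierI φ x‖ ≤ A * profile s x) (x : E) :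
    ‖fourierI (fun u => φ u * weightHat q u) x‖
      ≤ A * (κ * (2 ^ s * (2 * ∫ h : E, profile s h))) * profile s x := by
  have hA0 : 0 ≤ A := nonneg_of_mul_nonneg_left ((norm_nonneg _).trans (hA 0)) (profile_pos _ _)
  have hκ := hq.const_nonneg
  obtain ⟨hi, hle⟩ := integral_profile_conv_le hs x
  rw [hq.fourierI_mul_weightHat hs hφ]
  calc _ ≤ ∫ h, A * κ * (profile s (x - h) * profile s h) := by
        refine norm_integral_le_of_norm_le (hi.const_mul _) (Eventually.of_forall fun h => ?_)
        rw [norm_mul, Complex.norm_real, Real.norm_of_nonneg (hq.nonneg h)]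
        calc _ ≤ (A * profile s (x - h)) * (κ * profile s h) :=
              mul_le_mul (hA _) (hq.le h) (hq.nonneg h) ((norm_nonneg _).trans (hA _))
          _ = _ := by ring
    _ ≤ A * κ * (2 ^ s * (2 * ∫ h : E, profile s h) * profile s x) := by
        rw [integral_const_mul]; gcongr
    _ = _ := by ring

theorem norm_fourierI_mul_weightHat_pow_le (hq : IsTailWeight s κ q)
    (hs : (finrank ℝ E : ℝ) < s) {φ : E → ℂ} (hφ : Integrable φ) {A : ℝ}
    (hA : ∀ x, ‖fourierI φ x‖ ≤ A * profile s x) (n : ℕ) (x : E) :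
    ‖fourierI (fun u => φ u * weightHat q u ^ n) x‖
      ≤ A * (κ * (2 ^ s * (2 * ∫ h : E, profile s h))) ^ n * profile s x := by
  induction n generalizing x with
  | zero => simpa using hA x
  | succ n ih =>
    have := hq.norm_fourierI_mul_weightHat_le hs (hq.integrable_mul_weightHat_pow hs hφ n) ih x
    simp only [pow_succ, ← mul_assoc] at this ⊢
    exact this

/-- The exponential is expanded and integrated term by term, which is legitimate because `weightHat
q` is bounded by the total mass `Λ`. Each convolution with `q` multiplies the constant in the
profile bound by `c`, so the sum is `exp c`. -/
theorem norm_fourierI_mul_exp_weightHat_le (hq : IsTailWeight s κ q)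
    (hs : (finrank ℝ E : ℝ) < s) {φ : E → ℂ} (hφ : Integrable φ) {A : ℝ}
    (hA : ∀ x, ‖fourierI φ x‖ ≤ A * profile s x) (x : E) :
    ‖fourierI (fun u => φ u * Complex.exp (weightHat q u)) x‖
      ≤ A * Real.exp (κ * (2 ^ s * (2 * ∫ h : E, profile s h))) * profile s x := by
  set c := κ * (2 ^ s * (2 * ∫ h : E, profile s h)) with hc
  set Λ := ∫ h, q h with hΛ
  have he : ∀ u : E, ‖Complex.exp (-(Complex.I * (inner ℝ u x : ℝ)))‖ = 1 := fun u => by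
    rw [← mul_neg, ← Complex.ofReal_neg, ← inner_neg_right, norm_exp_I_inner]
  let F : ℕ → E → ℂ := fun n u => Complex.exp (-(Complex.I * (inner ℝ u x : ℝ))) *
    (φ u * weightHat q u ^ n) * ((n.factorial : ℂ))⁻¹
  have hF : ∀ n, Integrable (F n) := fun n => by
    refine Integrable.mul_const ((hq.integrable_mul_weightHat_pow hs hφ n).bdd_mul (c := 1)
      (by fun_prop : Continuous _).aestronglyMeasurable (Eventually.of_forall fun u => (he u).le)) _
  have hFn : ∀ n, ∫ u, ‖F n u‖ ≤ (∫ u, ‖φ u‖) * (Λ ^ n / n.factorial) := fun n => by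
    rw [← integral_mul_const]
    refine integral_mono (hF n).norm (hφ.norm.mul_const _) fun u => ?_
    simp only [F, norm_mul, he, one_mul, norm_pow, norm_inv, Complex.norm_natCast, div_eq_mul_inv]
    rw [mul_assoc]
    gcongr
    exact hq.norm_weightHat_le u
  have hsum := hasSum_integral_of_summable_integral_norm hF
    (Summable.of_nonneg_of_le (fun n => integral_nonneg fun u => norm_nonneg _) hFn
      ((Real.summable_pow_div_factorial Λ).mul_left _))
  have hlim : ∫ u, ∑' n, F n u = fourierI (fun u => φ u * Complex.exp (weightHat q u)) x := by
    refine integral_congr_ae (Eventually.of_forall fun u => ?_)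
    simp only [F, mul_assoc]
    rw [tsum_mul_left, tsum_mul_left, Complex.exp_eq_exp_ℂ, NormedSpace.exp_eq_tsum_div]
    simp only [div_eq_mul_inv]
  rw [hlim] at hsum
  have hterm : ∀ n, ‖∫ u, F n u‖ ≤ A * profile s x * (c ^ n / n.factorial) := fun n => by
    rw [integral_mul_const, norm_mul, norm_inv, Complex.norm_natCast, div_eq_mul_inv, ← mul_assoc]
    gcongr
    refine (hq.norm_fourierI_mul_weightHat_pow_le hs hφ hA n x).trans_eq ?_
    ring
  have hexp : HasSum (fun n : ℕ => A * profile s x * (c ^ n / n.factorial))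
      (A * profile s x * Real.exp c) := by
    rw [Real.exp_eq_exp_ℝ]
    exact (NormedSpace.expSeries_div_hasSum_exp c).mul_left _
  rw [← hsum.tsum_eq]
  exact (tsum_of_norm_bounded hexp hterm).trans_eq (by ring)

/-- The normalising factor `exp (-Λ)` is at most 1 and is discarded, so the constant depends on `q`
only through `κ`. -/
theorem norm_fourierI_mul_compoundPoisson_le (hq : IsTailWeight s κ q)
    (hs : (finrank ℝ E : ℝ) < s) {φ : E → ℂ} (hφ : Integrable φ) {A : ℝ}
    (hA : ∀ x, ‖fourierI φ x‖ ≤ A * profile s x) (x : E) :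
    ‖fourierI (fun u => φ u * Complex.exp (weightHat q u - (∫ h, q h : ℝ))) x‖
      ≤ A * Real.exp (κ * (2 ^ s * (2 * ∫ h : E, profile s h))) * profile s x := by
  have h1 : fourierI (fun u => φ u * Complex.exp (weightHat q u - (∫ h, q h : ℝ))) x
      = Complex.exp (-(∫ h, q h : ℝ)) * fourierI (fun u => φ u * Complex.exp (weightHat q u)) x := by
    simp only [fourierI]
    rw [← integral_const_mul]
    refine integral_congr_ae (Eventually.of_forall fun u => ?_)
    simp only [sub_eq_add_neg, Complex.exp_add]
    ring
  rw [h1, norm_mul, ← Complex.ofReal_neg, Complex.norm_exp_ofReal]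
  have h2 : Real.exp (-∫ h, q h) ≤ 1 :=
    Real.exp_le_one_iff.2 (neg_nonpos.2 (integral_nonneg hq.nonneg))
  exact (mul_le_of_le_one_left (norm_nonneg _) h2).trans
    (hq.norm_fourierI_mul_exp_weightHat_le hs hφ hA x)

end IsTailWeight

/-! ### The density at time one -/

/-- `K` is comparable to `|h|^(-d-α)` with constants `κ₀`, `κ₁`. -/
structure IsComparable (α κ₀ κ₁ : ℝ) (K : E → ℝ) : Prop where
  measurable : Measurable K
  lower : ∀ h : E, h ≠ 0 → κ₀ / ‖h‖ ^ ((finrank ℝ E : ℝ) + α) ≤ K h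
  upper : ∀ h : E, h ≠ 0 → K h ≤ κ₁ / ‖h‖ ^ ((finrank ℝ E : ℝ) + α)

/-- The part of `K` on the punctured unit ball. -/
noncomputable def localPart (K : E → ℝ) : E → ℝ :=
  (Metric.closedBall (0 : E) 1 \ {0}).indicator K

/-- The part of `K` outside the unit ball. -/
noncomputable def tailPart (K : E → ℝ) : E → ℝ :=
  (Metric.closedBall (0 : E) 1)ᶜ.indicator K

namespace IsComparable

variable {α κ₀ κ₁ : ℝ} {K : E → ℝ}

theorem nonneg (hK : IsComparable α κ₀ κ₁ K) (hκ₀ : 0 ≤ κ₀) {h : E} (hh : h ≠ 0) : 0 ≤ K h :=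
  le_trans (by positivity) (hK.lower h hh)

theorem pow_mul_abs_le (hK : IsComparable α κ₀ κ₁ K) (hκ₀ : 0 ≤ κ₀) {h : E} (hh : h ≠ 0)
    (n : ℕ) : ‖h‖ ^ n * |K h| ≤ κ₁ * ‖h‖ ^ ((n : ℝ) - finrank ℝ E - α) := by
  have h0 : 0 < ‖h‖ := norm_pos_iff.2 hh
  rw [abs_of_nonneg (hK.nonneg hκ₀ hh), sub_sub, Real.rpow_sub h0, Real.rpow_natCast]
  calc _ ≤ ‖h‖ ^ n * (κ₁ / ‖h‖ ^ ((finrank ℝ E : ℝ) + α)) := by gcongr; exact hK.upper h hh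
    _ = _ := by ring

theorem isLocalWeight [Nontrivial E] (hK : IsComparable α κ₀ κ₁ K) (hκ₀ : 0 ≤ κ₀)
    (hα2 : α < 2) : IsLocalWeight α κ₀
      (κ₁ * ∫ h in Metric.closedBall (0 : E) 1, ‖h‖ ^ ((2 : ℝ) - finrank ℝ E - α))
      (localPart K) := by
  have hms : MeasurableSet (Metric.closedBall (0 : E) 1 \ {0}) :=
    measurableSet_closedBall.diff (measurableSet_singleton 0)
  have hm : Measurable (localPart K) := hK.measurable.indicator hms
  have hi : IntegrableOn (fun h : E => κ₁ * ‖h‖ ^ ((2 : ℝ) - finrank ℝ E - α))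
      (Metric.closedBall 0 1) :=
    (integrableOn_norm_rpow_closedBall (by linarith)).const_mul κ₁
  have hi' := (integrable_indicator_iff measurableSet_closedBall).2 hi
  have hnn : ∀ h, 0 ≤ localPart K h := fun h =>
    Set.indicator_nonneg (fun x hx => hK.nonneg hκ₀ hx.2) h
  have hκ₁ : 0 ≤ κ₁ := by
    obtain ⟨e, he⟩ := exists_ne (0 : E)
    have h1 := (hK.nonneg hκ₀ he).trans (hK.upper e he)
    have h2 : 0 < ‖e‖ ^ ((finrank ℝ E : ℝ) + α) :=
      Real.rpow_pos_of_pos (norm_pos_iff.2 he) _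
    exact (div_nonneg_iff.1 h1).elim (fun h => h.1) (fun h => absurd h.2 (not_le.2 h2))
  have hle : ∀ h : E, ‖h‖ ^ 2 * |localPart K h| ≤ (Metric.closedBall (0 : E) 1).indicator
      (fun h : E => κ₁ * ‖h‖ ^ ((2 : ℝ) - finrank ℝ E - α)) h := fun h => by
    by_cases hh : h ∈ Metric.closedBall (0 : E) 1 \ {0}
    · rw [localPart, Set.indicator_of_mem hh, Set.indicator_of_mem hh.1]
      exact_mod_cast hK.pow_mul_abs_le hκ₀ hh.2 2
    · rw [localPart, Set.indicator_of_notMem hh, abs_zero, mul_zero]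
      exact Set.indicator_nonneg (fun x _ => by positivity) h
  have hint : Integrable fun h => ‖h‖ ^ 2 * |localPart K h| :=
    hi'.mono' (by fun_prop) (Eventually.of_forall fun h => by
      rw [Real.norm_of_nonneg (by positivity)]; exact hle h)
  refine ⟨hm, hnn, hint, ?_, fun h hh => ?_, fun h hh0 hh1 => ?_⟩
  · rw [← integral_const_mul, ← integral_indicator measurableSet_closedBall]
    exact integral_mono hint hi' hle
  · exact Set.indicator_of_notMem (fun hmem => by simp at hmem; linarith) _
  · have hmem : h ∈ Metric.closedBall (0 : E) 1 \ {0} := ⟨by simpa using hh1, hh0⟩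
    rw [localPart, Set.indicator_of_mem hmem]
    exact hK.lower h hh0

/-- Outside the unit ball `1 + |h| ≤ 2|h|`, which accounts for the factor `2 ^ (d + α)`. -/
theorem isTailWeight (hK : IsComparable α κ₀ κ₁ K) (hκ₀ : 0 ≤ κ₀) (hκ₁ : 0 ≤ κ₁) (hα : 0 < α) :
    IsTailWeight ((finrank ℝ E : ℝ) + α) (κ₁ * 2 ^ ((finrank ℝ E : ℝ) + α)) (tailPart K) := by
  have hd0 : (0 : ℝ) ≤ finrank ℝ E := Nat.cast_nonneg _
  have hne : ∀ h ∈ (Metric.closedBall (0 : E) 1)ᶜ, h ≠ 0 := by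
    rintro h hh rfl
    simp at hh
  refine ⟨hK.measurable.indicator measurableSet_closedBall.compl, fun h =>
    Set.indicator_nonneg (fun x hx => hK.nonneg hκ₀ (hne x hx)) h, fun h => ?_⟩
  by_cases hh : h ∈ (Metric.closedBall (0 : E) 1)ᶜ
  · have h1 : 1 < ‖h‖ := by simpa using hh
    rw [tailPart, Set.indicator_of_mem hh]
    refine (hK.upper h (hne h hh)).trans ?_
    rw [div_eq_mul_inv, mul_assoc]
    gcongr
    have : (0 : ℝ) < ‖h‖ := by linarith
    rw [profile, Real.rpow_neg (by positivity), ← div_eq_mul_inv, ← Real.div_rpow (by norm_num)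
      (by positivity), ← Real.inv_rpow (by positivity)]
    gcongr
    rw [inv_eq_one_div, div_le_div_iff₀ this (by positivity)]
    linarith
  · rw [tailPart, Set.indicator_of_notMem hh]
    exact mul_nonneg (by positivity) (profile_pos _ _).le

end IsComparable

/-- The characteristic function at time one for the kernel `K`, when the jumps in the unit ball are
compensated and `b` is the drift. -/
noncomputable def unitCharFun (K : E → ℝ) (b u : E) : ℂ :=
  localCharFun (localPart K) b u *
    Complex.exp (weightHat (tailPart K) u - (∫ h, tailPart K h : ℝ))

theorem inv_pow_le_profile {N : ℕ} {s : ℝ} (hs : s ≤ N) (x : E) :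
    ((1 + ‖x‖) ^ N)⁻¹ ≤ profile s x := by
  rw [profile, Real.rpow_neg (by positivity), ← Real.rpow_natCast]
  gcongr
  linarith [norm_nonneg x]

theorem IsTailWeight.norm_compoundPoisson_le {s κ : ℝ} {q : E → ℝ} (hq : IsTailWeight s κ q)
    (u : E) : ‖Complex.exp (weightHat q u - (∫ h, q h : ℝ))‖ ≤ 1 := by
  rw [Complex.norm_exp, Real.exp_le_one_iff, Complex.sub_re, Complex.ofReal_re, sub_nonpos]
  exact (Complex.re_le_norm _).trans (hq.norm_weightHat_le u)

theorem exists_unitCharFun_bounds [Nontrivial E] {α κ₀ κ₁ B : ℝ} (hα0 : 0 < α) (hα2 : α < 2)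
    (hκ₀ : 0 < κ₀) (hκ₁ : 0 < κ₁) (hB : 0 ≤ B) :
    ∃ C : ℝ, 0 < C ∧ ∀ (K : E → ℝ) (b : E), IsComparable α κ₀ κ₁ K → ‖b‖ ≤ B →
      Continuous (unitCharFun K b) ∧
      Integrable (unitCharFun K b) ∧ Integrable (fun u => ‖u‖ * ‖unitCharFun K b u‖) ∧
      (∀ x, ‖fourierI (unitCharFun K b) x‖ ≤ C * profile ((finrank ℝ E : ℝ) + α) x) ∧
      (∀ x e, ‖fourierI (fun u => (inner ℝ u e : ℝ) * unitCharFun K b u) x‖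
        ≤ C * ‖e‖ * profile ((finrank ℝ E : ℝ) + α) x) := by
  set s := (finrank ℝ E : ℝ) + α with hs
  have hds : (finrank ℝ E : ℝ) < s := by linarith
  set M := κ₁ * ∫ h in Metric.closedBall (0 : E) 1, ‖h‖ ^ ((2 : ℝ) - finrank ℝ E - α)
  have hM : 0 ≤ M := mul_nonneg hκ₁.le (integral_nonneg fun h => by positivity)
  -- Since `α < 2`, decay of integer order `d + 2` already lies below the profile.
  have hsN : s ≤ ((finrank ℝ E + 2 : ℕ) : ℝ) := by push_cast; linarith
  obtain ⟨A, hA, hfast⟩ := exists_hasFastDerivs_localCharFun (E := E) hκ₀ hα0 hM hB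
    (finrank ℝ E + 2)
  obtain ⟨C, hC, hdecay⟩ := exists_fourierI_decay (E := E) (finrank ℝ E + 2) A hA
  set X := Real.exp (κ₁ * 2 ^ s * (2 ^ s * (2 * ∫ h : E, profile s h)))
  refine ⟨C * X, by positivity, fun K b hK hb => ?_⟩
  have hk := hK.isLocalWeight hκ₀.le hα2
  have hq := hK.isTailWeight hκ₀.le hκ₁.le hα0
  have hf := hfast _ b hk hb
  have hcont : Continuous fun u => Complex.exp (weightHat (tailPart K) u
      - (∫ h, tailPart K h : ℝ)) :=
    ((hq.continuous_weightHat hds).sub continuous_const).cexp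
  have hloc : Integrable (localCharFun (localPart K) b) := by
    have := hf.integrable (n := 0) (p := 0) (Nat.zero_le _) zero_le_one
    simp only [pow_zero, one_mul, norm_iteratedFDeriv_zero] at this
    exact (integrable_norm_iff hf.1.continuous.aestronglyMeasurable).1 this
  have hloc1 : Integrable fun u => ‖u‖ * ‖localCharFun (localPart K) b u‖ := by
    simpa using hf.integrable (n := 0) (p := 1) (Nat.zero_le _) le_rfl
  have hloc2 : ∀ e : E, Integrable fun u =>
      ((inner ℝ u e : ℝ) : ℂ) * localCharFun (localPart K) b u := fun e => by
    refine (hloc1.mul_const ‖e‖).mono' (Continuous.aestronglyMeasurable ?_)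
      (Eventually.of_forall fun u => ?_)
    · exact Continuous.mul (by fun_prop) hf.1.continuous
    · rw [norm_mul, Complex.norm_real, mul_right_comm]
      gcongr
      exact norm_inner_le_norm u e
  have hcu : Continuous (unitCharFun K b) := hf.1.continuous.mul hcont
  have hle : ∀ u, ‖unitCharFun K b u‖ ≤ ‖localCharFun (localPart K) b u‖ := fun u => by
    rw [unitCharFun, norm_mul]
    exact mul_le_of_le_one_right (norm_nonneg _) (hq.norm_compoundPoisson_le u)
  refine ⟨hcu, hloc.mono hcu.aestronglyMeasurable (Eventually.of_forall hle),
    hloc1.mono' (continuous_norm.mul hcu.norm).aestronglyMeasurable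
      (Eventually.of_forall fun u => ?_), fun x => ?_, fun x e => ?_⟩
  · rw [norm_mul, norm_norm, norm_norm]
    gcongr
    exact hle u
  · refine (hq.norm_fourierI_mul_compoundPoisson_le hds hloc (A := C) (fun x => ?_) x)
    calc _ ≤ C * ((1 + ‖x‖) ^ (finrank ℝ E + 2))⁻¹ := by
          simpa using hdecay _ hf 0 zero_le_one x
      _ ≤ _ := by gcongr; exact inv_pow_le_profile hsN x
  -- The factor `⟨u, e⟩` is attached to the local part, where it represents a derivative of a
  -- rapidly decaying transform; the tail needs no smoothness.
  · have := hq.norm_fourierI_mul_compoundPoisson_le hds (hloc2 e) (A := C * ‖e‖) (fun x => ?_) x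
    · refine le_trans (le_of_eq ?_) (this.trans_eq ?_)
      · simp only [unitCharFun, mul_assoc]
      · simp only [X]; ring
    · have h1 := (hasFDerivAt_fourierI hloc hloc1 x).2 e
      have h2 : ‖fourierI (fun u => ((inner ℝ u e : ℝ) : ℂ) * localCharFun (localPart K) b u) x‖
          = ‖fderiv ℝ (fourierI (localCharFun (localPart K) b)) x e‖ := by
        rw [h1, norm_mul, norm_neg, Complex.norm_I, one_mul]
      rw [h2]
      have h3 := hdecay _ hf 1 le_rfl x
      rw [← norm_iteratedFDeriv_fderiv, norm_iteratedFDeriv_zero] at h3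
      calc _ ≤ _ := ContinuousLinearMap.le_opNorm _ e
        _ ≤ C * profile s x * ‖e‖ := by
          gcongr
          exact h3.trans (by gcongr; exact inv_pow_le_profile hsN x)
        _ = _ := by ring

end General

/-! ### Reduction to time one by scaling -/

section Scaling

variable {d : ℕ} {α κ₀ κ₁ : ℝ} {K : Rd d → ℝ}

theorem nontrivial_Rd (hd : 1 ≤ d) : Nontrivial (Rd d) :=
  have : Nonempty (Fin d) := ⟨⟨0, hd⟩⟩
  inferInstance

/-- The kernel of the process rescaled in space by the factor `r`. -/
noncomputable def scaledKernel (α r : ℝ) (K : Rd d → ℝ) (h : Rd d) : ℝ :=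
  r ^ ((d : ℝ) + α) * K (r • h)

theorem IsStableLikeKernel.isComparable_scaledKernel (hK : IsStableLikeKernel α κ₀ κ₁ K) {r : ℝ}
    (hr : 0 < r) : IsComparable α κ₀ κ₁ (scaledKernel α r K) := by
  have key : ∀ (c : ℝ) (h : Rd d), c / ‖h‖ ^ ((finrank ℝ (Rd d) : ℝ) + α)
      = r ^ ((d : ℝ) + α) * (c / ‖r • h‖ ^ ((d : ℝ) + α)) := fun c h => by
    have : r ^ ((d : ℝ) + α) ≠ 0 := (Real.rpow_pos_of_pos hr _).ne'
    rw [norm_smul, Real.norm_of_nonneg hr.le, Real.mul_rpow hr.le (norm_nonneg h),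
      finrank_euclideanSpace_fin]
    field_simp
  refine ⟨?_, fun h hh => ?_, fun h hh => ?_⟩
  · exact (hK.measurable.comp (measurable_const_smul r)).const_mul _
  · rw [key, scaledKernel]
    gcongr
    exact hK.lower _ (smul_ne_zero hr.ne' hh)
  · rw [key, scaledKernel]
    gcongr
    exact hK.upper _ (smul_ne_zero hr.ne' hh)

theorem IsStableLikeKernel.integral_sphere_eq_zero (hK : IsStableLikeKernel α κ₀ κ₁ K)
    (hα : α = 1) {r : ℝ} (hr : 0 < r) :
    ∫ ω : Metric.sphere (0 : Rd d) 1, K (r • (ω : Rd d)) • (ω : Rd d)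
      ∂(volume : Measure (Rd d)).toSphere = 0 := by
  have h := hK.moment hα r hr
  have hm : Measurable fun h : Rd d => K h • h := hK.measurable.smul measurable_id
  rw [surfaceMeasure, integral_smul_measure, integral_map (by fun_prop) hm.aestronglyMeasurable]
    at h
  have h2 : ∫ ω : Metric.sphere (0 : Rd d) 1, K (r • (ω : Rd d)) • r • (ω : Rd d)
      ∂(volume : Measure (Rd d)).toSphere = r • ∫ ω : Metric.sphere (0 : Rd d) 1,
        K (r • (ω : Rd d)) • (ω : Rd d) ∂(volume : Measure (Rd d)).toSphere := by
    rw [← integral_smul]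
    exact integral_congr_ae (Eventually.of_forall fun ω => smul_comm _ _ _)
  rw [h2, ENNReal.toReal_ofReal (by positivity), smul_smul, smul_eq_zero] at h
  exact h.resolve_left (by positivity)

/-- In polar coordinates a radial weight is constant on each sphere, so every spherical integral
vanishes by the moment condition. -/
theorem IsStableLikeKernel.integral_radial_eq_zero (hd : 1 ≤ d)
    (hK : IsStableLikeKernel α κ₀ κ₁ K)
    (hα : α = 1) {r : ℝ} (hr : 0 < r) (g : ℝ → ℝ) :
    ∫ h : Rd d, (g ‖h‖ * scaledKernel α r K h) • h = 0 := by
  have := nontrivial_Rd hd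
  set F : Rd d → Rd d := fun h => (g ‖h‖ * scaledKernel α r K h) • h with hF
  -- Without integrability the integral is 0 by convention, so the identity is unconditional.
  by_cases hint : Integrable F
  swap
  · exact integral_undef hint
  let e := homeomorphUnitSphereProd (Rd d)
  have hmp := (volume : Measure (Rd d)).measurePreserving_homeomorphUnitSphereProd
  let G : Metric.sphere (0 : Rd d) 1 × Set.Ioi (0 : ℝ) → Rd d := fun p => F (e.symm p)
  have h1 : ∫ h, F h = ∫ p, G p ∂((volume : Measure (Rd d)).toSphere.prod
      (.volumeIoiPow (finrank ℝ (Rd d) - 1))) := by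
    rw [← hmp.integral_comp (Homeomorph.measurableEmbedding _) G]
    have : ∀ x, G (homeomorphUnitSphereProd (Rd d) x) = F x := fun x => by
      simp only [G, e, Homeomorph.symm_apply_apply]
    simp only [this]
    rw [integral_subtype_comap (measurableSet_singleton _).compl F, restrict_compl_singleton]
  have hG : Integrable G ((volume : Measure (Rd d)).toSphere.prod
      (.volumeIoiPow (finrank ℝ (Rd d) - 1))) := by
    rw [← hmp.integrable_comp_emb (Homeomorph.measurableEmbedding _)]
    have : G ∘ (homeomorphUnitSphereProd (Rd d)) = F ∘ Subtype.val := by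
      ext1 x
      simp only [G, e, Function.comp, Homeomorph.symm_apply_apply]
    rw [this, ← integrableOn_iff_comap_subtypeVal (measurableSet_singleton _).compl]
    exact hint.integrableOn
  rw [h1, integral_prod_symm _ hG]
  refine integral_eq_zero_of_ae (Eventually.of_forall fun s => ?_)
  have hs : 0 < (s : ℝ) := s.2
  have h2 : ∀ ω : Metric.sphere (0 : Rd d) 1, G (ω, s)
      = (g s * r ^ ((d : ℝ) + α) * s) • K ((r * s) • (ω : Rd d)) • (ω : Rd d) := fun ω => by
    have hω : ‖(ω : Rd d)‖ = 1 := by simp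
    have hsymm : ((e.symm (ω, s) : ({0}ᶜ : Set (Rd d))) : Rd d) = (s : ℝ) • (ω : Rd d) := rfl
    simp only [G, F, hsymm, scaledKernel, norm_smul, hω, mul_one, Real.norm_of_nonneg hs.le,
      smul_smul]
    congr 1
    ring
  simp only [h2]
  rw [integral_smul, hK.integral_sphere_eq_zero hα (mul_pos hr hs), smul_zero]
  rfl

/-- The difference between the compensator on the unit ball and the rescaled compensator. -/
noncomputable def cutoffDiff (α r : ℝ) (h : Rd d) : ℝ :=
  (if ‖h‖ ≤ 1 then 1 else 0) - chi α (r • h)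

theorem measurable_chi : Measurable (chi α : Rd d → ℝ) := by
  unfold chi
  refine measurable_const.add (Measurable.ite ?_ measurable_const measurable_const)
  exact (MeasurableSet.const _).inter (measurableSet_le measurable_norm measurable_const)

theorem measurable_cutoffDiff (r : ℝ) : Measurable (cutoffDiff α r : Rd d → ℝ) := by
  unfold cutoffDiff
  refine (Measurable.ite (measurableSet_le measurable_norm measurable_const)
    measurable_const measurable_const).sub ?_
  exact measurable_chi.comp (measurable_const_smul r)

/-- The drift of the rescaled process at time one. -/
noncomputable def scaledDrift (α r : ℝ) (K : Rd d → ℝ) : Rd d :=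
  ∫ h, (cutoffDiff α r h * scaledKernel α r K h) • h

/-- A bound for the drift of the rescaled process. -/
noncomputable def driftBound (d : ℕ) (α κ₁ : ℝ) : ℝ :=
  (∫ h in Metric.closedBall (0 : Rd d) 1, κ₁ * ‖h‖ ^ ((1 : ℝ) - d - α)) +
    ∫ h in (Metric.closedBall (0 : Rd d) 1)ᶜ, κ₁ * ‖h‖ ^ ((1 : ℝ) - d - α)

theorem driftBound_nonneg (hκ₁ : 0 ≤ κ₁) : 0 ≤ driftBound d α κ₁ :=
  add_nonneg (integral_nonneg fun h => by positivity) (integral_nonneg fun h => by positivity)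

theorem norm_drift_integrand_le (hK : IsStableLikeKernel α κ₀ κ₁ K) (hκ₀ : 0 ≤ κ₀)
    {r : ℝ} (hr : 0 < r) (w : ℝ) {h : Rd d} (hh : h ≠ 0) :
    ‖(w * scaledKernel α r K h) • h‖ ≤ |w| * (κ₁ * ‖h‖ ^ ((1 : ℝ) - d - α)) := by
  have := (hK.isComparable_scaledKernel hr).pow_mul_abs_le hκ₀ hh 1
  rw [finrank_euclideanSpace_fin] at this
  rw [norm_smul, norm_mul, Real.norm_eq_abs, Real.norm_eq_abs, mul_assoc]
  refine mul_le_mul_of_nonneg_left ?_ (abs_nonneg w)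
  rw [mul_comm]
  simpa using this

theorem integrable_drift_of_le [Nontrivial (Rd d)] (hK : IsStableLikeKernel α κ₀ κ₁ K) {r : ℝ} {S : Set (Rd d)}
    (hS : MeasurableSet S) {b : Rd d → ℝ} (hb : IntegrableOn b S)
    (hle : ∀ h : Rd d, h ≠ 0 →
      ‖(cutoffDiff α r h * scaledKernel α r K h) • h‖ ≤ S.indicator b h) :
    Integrable (fun h : Rd d => (cutoffDiff α r h * scaledKernel α r K h) • h) ∧
      ‖scaledDrift α r K‖ ≤ ∫ h in S, b h := by
  have hle' : ∀ᵐ h : Rd d, ‖(cutoffDiff α r h * scaledKernel α r K h) • h‖ ≤ S.indicator b h := by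
    filter_upwards [compl_mem_ae_iff.2 (measure_singleton (0 : Rd d))] with h hh using hle h hh
  have hm : Measurable fun h : Rd d => (cutoffDiff α r h * scaledKernel α r K h) • h :=
    ((measurable_cutoffDiff r).mul
      ((hK.measurable.comp (measurable_const_smul r)).const_mul _)).smul measurable_id
  have hb' := (integrable_indicator_iff hS).2 hb
  refine ⟨hb'.mono' hm.aestronglyMeasurable hle', ?_⟩
  rw [← integral_indicator hS]
  exact norm_integral_le_of_norm_le hb' hle'

theorem integrableOn_drift_bound (s : ℝ) (a b : ℝ) (ha : 0 < a) :
    IntegrableOn (fun h : Rd d => κ₁ * ‖h‖ ^ s) {h | a ≤ ‖h‖ ∧ ‖h‖ ≤ b} := by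
  have hS : IsCompact {h : Rd d | a ≤ ‖h‖ ∧ ‖h‖ ≤ b} := by
    refine (isCompact_closedBall (0 : Rd d) b).of_isClosed_subset ?_ fun h hh => by simpa using hh.2
    exact (isClosed_le continuous_const continuous_norm).inter
      (isClosed_le continuous_norm continuous_const)
  refine ContinuousOn.integrableOn_compact hS (continuousOn_const.mul ?_)
  exact continuous_norm.continuousOn.rpow_const fun h hh => Or.inl (by linarith [hh.1])

/-- The cutoff difference lives on the unit ball if `α < 1` and on its complement if `α > 1`; in
both cases `|h| ^ (1 - d - α)` is integrable there. If `α = 1` it lives on the shell between radii 1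
and `r⁻¹`, where absolute estimates degenerate logarithmically in `r`; only the cancellation on
spheres gives a uniform bound, the drift being 0. -/
theorem drift_bounds (hd : 1 ≤ d) (hK : IsStableLikeKernel α κ₀ κ₁ K) (hκ₀ : 0 ≤ κ₀)
    (hκ₁ : 0 ≤ κ₁) {r : ℝ} (hr : 0 < r) :
    Integrable (fun h : Rd d => (cutoffDiff α r h * scaledKernel α r K h) • h) ∧
      ‖scaledDrift α r K‖ ≤ driftBound d α κ₁ := by
  have := nontrivial_Rd hd
  have hB1 : 0 ≤ ∫ h in Metric.closedBall (0 : Rd d) 1, κ₁ * ‖h‖ ^ ((1 : ℝ) - d - α) :=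
    integral_nonneg fun h => by positivity
  have hB2 : 0 ≤ ∫ h in (Metric.closedBall (0 : Rd d) 1)ᶜ, κ₁ * ‖h‖ ^ ((1 : ℝ) - d - α) :=
    integral_nonneg fun h => by positivity
  have hle : ∀ S : Set (Rd d), (∀ h, |cutoffDiff α r h| ≤ S.indicator 1 h) → ∀ h : Rd d, h ≠ 0 →
      ‖(cutoffDiff α r h * scaledKernel α r K h) • h‖
        ≤ S.indicator (fun h => κ₁ * ‖h‖ ^ ((1 : ℝ) - d - α)) h := fun S hS h hh => by
    refine (norm_drift_integrand_le hK hκ₀ hr _ hh).trans ?_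
    have h1 := hS h
    by_cases hmem : h ∈ S
    · rw [Set.indicator_of_mem hmem] at h1 ⊢
      exact mul_le_of_le_one_left (by positivity) h1
    · rw [Set.indicator_of_notMem hmem] at h1 ⊢
      exact mul_nonpos_of_nonpos_of_nonneg h1 (by positivity)
  rcases lt_trichotomy α 1 with hα | hα | hα
  · have hi : IntegrableOn (fun h : Rd d => κ₁ * ‖h‖ ^ ((1 : ℝ) - d - α))
        (Metric.closedBall 0 1) := by
      refine (integrableOn_norm_rpow_closedBall ?_).const_mul κ₁
      rw [finrank_euclideanSpace_fin]; linarith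
    obtain ⟨h1, h2⟩ := integrable_drift_of_le hK measurableSet_closedBall hi (hle _ fun h => by
      simp [cutoffDiff, chi, hα.not_gt, hα.ne, Set.indicator, apply_ite abs])
    exact ⟨h1, h2.trans (le_add_of_nonneg_right hB2)⟩
  · have hle1 := hle {h | min 1 r⁻¹ ≤ ‖h‖ ∧ ‖h‖ ≤ max 1 r⁻¹} fun h => by
      have hrh : ‖r • h‖ ≤ 1 ↔ ‖h‖ ≤ r⁻¹ := by
        rw [norm_smul, Real.norm_of_nonneg hr.le, mul_comm, ← le_div_iff₀ hr, one_div]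
      simp only [cutoffDiff, chi, hα, lt_irrefl, if_false, true_and, zero_add, hrh,
        Set.indicator, Set.mem_ofPred_eq, Pi.one_apply]
      by_cases h1 : ‖h‖ ≤ 1 <;> by_cases h2 : ‖h‖ ≤ r⁻¹
      · simp only [h1, h2, if_true, sub_self, abs_zero]
        split_ifs <;> norm_num
      · have hm : min 1 r⁻¹ ≤ ‖h‖ ∧ ‖h‖ ≤ max 1 r⁻¹ :=
          ⟨(min_le_right _ _).trans (not_le.1 h2).le, h1.trans (le_max_left _ _)⟩
        rw [if_pos hm, if_pos h1, if_neg h2]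
        norm_num
      · have hm : min 1 r⁻¹ ≤ ‖h‖ ∧ ‖h‖ ≤ max 1 r⁻¹ :=
          ⟨(min_le_left _ _).trans (not_le.1 h1).le, h2.trans (le_max_right _ _)⟩
        rw [if_pos hm, if_neg h1, if_pos h2]
        norm_num
      · simp only [h1, h2, if_false, sub_self, abs_zero]
        split_ifs <;> norm_num
    have hms : MeasurableSet {h : Rd d | min 1 r⁻¹ ≤ ‖h‖ ∧ ‖h‖ ≤ max 1 r⁻¹} :=
      (measurableSet_le measurable_const measurable_norm).inter
        (measurableSet_le measurable_norm measurable_const)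
    obtain ⟨h1, -⟩ := integrable_drift_of_le hK hms
      (integrableOn_drift_bound _ _ _ (lt_min one_pos (inv_pos.2 hr))) hle1
    refine ⟨h1, ?_⟩
    have h0 : scaledDrift α r K = 0 := by
      have := hK.integral_radial_eq_zero hd hα hr
        (fun s => (if s ≤ 1 then 1 else 0) - if r * s ≤ 1 then 1 else 0)
      rw [← this, scaledDrift]
      simp only [cutoffDiff, chi, hα, lt_irrefl, if_false, true_and, zero_add, norm_smul,
        Real.norm_of_nonneg hr.le]
    rw [h0, norm_zero]
    exact driftBound_nonneg hκ₁
  · have hi : IntegrableOn (fun h : Rd d => κ₁ * ‖h‖ ^ ((1 : ℝ) - d - α))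
        (Metric.closedBall 0 1)ᶜ := by
      refine (integrableOn_norm_rpow_compl_closedBall ?_).const_mul κ₁
      rw [finrank_euclideanSpace_fin]; linarith
    obtain ⟨h1, h2⟩ := integrable_drift_of_le hK measurableSet_closedBall.compl hi
      (hle _ fun h => by
        by_cases hh : ‖h‖ ≤ 1 <;>
          simp [cutoffDiff, chi, hα, hα.ne', Set.indicator, hh])
    exact ⟨h1, h2.trans (le_add_of_nonneg_left hB1)⟩

/-- Substituting `r • h` for `h` produces the Jacobian `r ^ d`, which with `r ^ α` forms the scaled
kernel. The integrand is then split at the unit sphere, and the mismatch of compensators is the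
drift term. -/
theorem neg_mul_psi_eq (hd : 1 ≤ d) (hα0 : 0 < α) (hα2 : α < 2)
    (hK : IsStableLikeKernel α κ₀ κ₁ K)
    (hκ₀ : 0 ≤ κ₀) (hκ₁ : 0 ≤ κ₁) {r : ℝ} (hr : 0 < r) (u : Rd d) :
    -(((r ^ α : ℝ) : ℂ) * psi α K u) =
      compensated (localPart (scaledKernel α r K)) (r • u)
        + Complex.I * (inner ℝ (r • u) (scaledDrift α r K) : ℝ)
        + (weightHat (tailPart (scaledKernel α r K)) (r • u)
          - (∫ h, tailPart (scaledKernel α r K) h : ℝ)) := by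
  have := nontrivial_Rd hd
  set K' := scaledKernel α r K with hK'
  have hcomp := hK.isComparable_scaledKernel hr
  have hk := hcomp.isLocalWeight hκ₀ hα2
  have hq := hcomp.isTailWeight hκ₀ hκ₁ hα0
  have hds : (finrank ℝ (Rd d) : ℝ) < finrank ℝ (Rd d) + α := by linarith
  obtain ⟨hdi, -⟩ := drift_bounds hd hK hκ₀ hκ₁ hr
  set v := r • u with hv
  let G : Rd d → ℂ := fun h => (Complex.exp (Complex.I * (inner ℝ u h : ℝ)) - 1
      - (chi α h : ℂ) * (Complex.I * (inner ℝ u h : ℝ))) * (K h : ℂ)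
  have hLHS : -(((r ^ α : ℝ) : ℂ) * psi α K u) =
      ∫ h : Rd d, ((r ^ ((d : ℝ) + α) : ℝ) : ℂ) * G (r • h) := by
    rw [integral_const_mul, Measure.integral_comp_smul, psi, restrict_compl_singleton,
      finrank_euclideanSpace_fin, abs_of_pos (by positivity), Real.rpow_add hr, Real.rpow_natCast,
      Complex.real_smul]
    have : ((r : ℂ)) ≠ 0 := by exact_mod_cast hr.ne'
    simp only [G]
    push_cast
    field_simp
  have h1 := integrable_compensated hk.measurable hk.integrable v
  have h2 : Integrable fun h : Rd d =>
      Complex.I * ((inner ℝ v ((cutoffDiff α r h * K' h) • h) : ℝ) : ℂ) :=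
    (hdi.const_inner v).ofReal.const_mul _
  have h3 := (hq.integrable_exp_mul hds v).sub ((hq.integrable hds).ofReal (𝕜 := ℂ))
  have e2 : Complex.I * (inner ℝ v (scaledDrift α r K) : ℝ) = ∫ h : Rd d,
      Complex.I * ((inner ℝ v ((cutoffDiff α r h * K' h) • h) : ℝ) : ℂ) := by
    rw [integral_const_mul, integral_complex_ofReal, integral_inner hdi, scaledDrift]
  have e3 : weightHat (tailPart K') v - (∫ h, tailPart K' h : ℝ) = ∫ h : Rd d,
      (Complex.exp (Complex.I * (inner ℝ v h : ℝ)) * (tailPart K' h : ℂ) - (tailPart K' h : ℂ)) := by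
    rw [← integral_complex_ofReal, weightHat]
    exact (integral_sub (hq.integrable_exp_mul hds v) ((hq.integrable hds).ofReal (𝕜 := ℂ))).symm
  rw [hLHS, e2, e3, compensated, ← integral_add h1 h2]
  refine Eq.trans (integral_congr_ae ?_) (integral_add (h1.add h2) h3)
  filter_upwards [compl_mem_ae_iff.2 (measure_singleton (0 : Rd d))] with h hh
  have hin : inner ℝ u (r • h) = inner ℝ v h := by
    rw [hv, inner_smul_left, inner_smul_right]; rfl
  have hh0 : h ≠ 0 := hh
  simp only [G, hin, inner_smul_right, cutoffDiff, localPart, tailPart, Set.indicator]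
  have hKK : ((K' h : ℝ) : ℂ) = ((r ^ ((d : ℝ) + α) : ℝ) : ℂ) * (K (r • h) : ℂ) := by
    rw [hK', scaledKernel]; push_cast; rfl
  by_cases h1 : ‖h‖ ≤ 1
  · have hm : h ∈ Metric.closedBall (0 : Rd d) 1 \ {0} := ⟨by simpa using h1, hh0⟩
    have hm' : h ∉ (Metric.closedBall (0 : Rd d) 1)ᶜ := by simpa using h1
    rw [if_pos hm, if_neg hm', if_pos h1]
    push_cast
    rw [hKK]
    ring
  · have hm : h ∉ Metric.closedBall (0 : Rd d) 1 \ {0} := fun hm => h1 (by simpa using hm.1)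
    have hm' : h ∈ (Metric.closedBall (0 : Rd d) 1)ᶜ := by simpa using h1
    rw [if_neg hm, if_pos hm', if_neg h1]
    push_cast
    rw [hKK]
    ring

theorem exp_neg_mul_psi_eq (hd : 1 ≤ d) (hα0 : 0 < α) (hα2 : α < 2)
    (hK : IsStableLikeKernel α κ₀ κ₁ K)
    (hκ₀ : 0 ≤ κ₀) (hκ₁ : 0 ≤ κ₁) {t : ℝ} (ht : 0 < t) (u : Rd d) :
    Complex.exp (-((t : ℂ) * psi α K u)) =
      unitCharFun (scaledKernel α (t ^ (1 / α)) K) (scaledDrift α (t ^ (1 / α)) K)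
        (t ^ (1 / α) • u) := by
  have h := neg_mul_psi_eq hd hα0 hα2 hK hκ₀ hκ₁ (Real.rpow_pos_of_pos ht (1 / α)) u
  rw [← Real.rpow_mul ht.le, one_div_mul_cancel hα0.ne', Real.rpow_one] at h
  rw [h, Complex.exp_add]
  rfl

theorem density_eq (hd : 1 ≤ d) (hα0 : 0 < α) (hα2 : α < 2)
    (hK : IsStableLikeKernel α κ₀ κ₁ K)
    (hκ₀ : 0 ≤ κ₀) (hκ₁ : 0 ≤ κ₁) {t : ℝ} (ht : 0 < t) (x : Rd d) :
    density α K t x = (1 / (2 * Real.pi) ^ d) * ((t ^ (1 / α)) ^ d)⁻¹ *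
      (fourierI (unitCharFun (scaledKernel α (t ^ (1 / α)) K) (scaledDrift α (t ^ (1 / α)) K))
        ((t ^ (1 / α))⁻¹ • x)).re := by
  have hr : 0 < t ^ (1 / α) := Real.rpow_pos_of_pos ht _
  set r := t ^ (1 / α) with hrdef
  set Φ := unitCharFun (scaledKernel α r K) (scaledDrift α r K) with hΦ
  have h1 : ∀ u : Rd d, Complex.exp (-(Complex.I * (inner ℝ u x : ℝ)))
      * Complex.exp (-((t : ℂ) * psi α K u))
      = (fun v => Complex.exp (-(Complex.I * (inner ℝ v (r⁻¹ • x) : ℝ))) * Φ v) (r • u) :=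
    fun u => by
      have : inner ℝ (r • u) (r⁻¹ • x) = inner ℝ u x := by
        rw [inner_smul_left, inner_smul_right]
        simp [hr.ne']
      simp only [this]
      rw [exp_neg_mul_psi_eq hd hα0 hα2 hK hκ₀ hκ₁ ht u]
  rw [density, integral_congr_ae (Eventually.of_forall h1), Measure.integral_comp_smul volume
    (fun v => Complex.exp (-(Complex.I * (inner ℝ v (r⁻¹ • x) : ℝ))) * Φ v) r,
    finrank_euclideanSpace_fin, abs_of_pos (by positivity),
    Complex.smul_re, smul_eq_mul, ← mul_assoc]
  rfl

end Scaling

/-! ### Bounds at all times and identification of the density -/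

section Bounds

variable {d : ℕ} {α κ₀ κ₁ : ℝ}

theorem inv_pow_mul_profile_eq {r s : ℝ} (hr : 0 < r) (x : Rd d) :
    (r ^ d)⁻¹ * profile ((d : ℝ) + s) (r⁻¹ • x) = r ^ s * (r + ‖x‖) ^ (-(d : ℝ) - s) := by
  have h1 : 1 + ‖r⁻¹ • x‖ = r⁻¹ * (r + ‖x‖) := by
    rw [norm_smul, Real.norm_of_nonneg (inv_nonneg.2 hr.le)]
    field_simp
  rw [profile, h1, Real.mul_rpow (by positivity) (by positivity), neg_add', ← mul_assoc,
    Real.inv_rpow hr.le, ← Real.rpow_neg hr.le, neg_sub, sub_neg_eq_add, Real.rpow_add hr,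
    Real.rpow_natCast]
  congr 1
  field_simp

/-- The part of the theorem that does not involve the process. -/
theorem exists_density_bounds (hd : 1 ≤ d) (hα0 : 0 < α) (hα2 : α < 2) (hκ₀ : 0 < κ₀)
    (hκ₁ : 0 < κ₁) :
    ∃ C : ℝ, 0 < C ∧ ∀ K : Rd d → ℝ, IsStableLikeKernel α κ₀ κ₁ K → ∀ t : ℝ, 0 < t →
      Continuous (fun u : Rd d => Complex.exp (-((t : ℂ) * psi α K u))) ∧
      Integrable (fun u : Rd d => Complex.exp (-((t : ℂ) * psi α K u))) ∧
      ∀ x, |density α K t x| ≤ C * t * (t ^ (1 / α) + ‖x‖) ^ (-(d : ℝ) - α) ∧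
        DifferentiableAt ℝ (density α K t) x ∧
        ‖gradient (density α K t) x‖
          ≤ C * t ^ (1 - 1 / α) * (t ^ (1 / α) + ‖x‖) ^ (-(d : ℝ) - α) := by
  have := nontrivial_Rd hd
  obtain ⟨C, hC, hbd⟩ := exists_unitCharFun_bounds (E := Rd d) hα0 hα2 hκ₀ hκ₁
    (driftBound_nonneg (d := d) (α := α) hκ₁.le)
  refine ⟨1 / (2 * Real.pi) ^ d * C, by positivity, fun K hK t ht => ?_⟩
  have hr : 0 < t ^ (1 / α) := Real.rpow_pos_of_pos ht _
  have hrα : (t ^ (1 / α)) ^ α = t := by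
    rw [← Real.rpow_mul ht.le, one_div_mul_cancel hα0.ne', Real.rpow_one]
  have hexp := fun u => exp_neg_mul_psi_eq hd hα0 hα2 hK hκ₀.le hκ₁.le ht u
  have hdens := funext fun x => density_eq hd hα0 hα2 hK hκ₀.le hκ₁.le ht x
  obtain ⟨hc, hi, hi1, hb0, hb1⟩ := hbd _ _ (hK.isComparable_scaledKernel hr)
    (drift_bounds hd hK hκ₀.le hκ₁.le hr).2
  -- The chain rule for `x ↦ r⁻¹ • x` contributes one extra `r⁻¹` to the gradient, which explains
  -- the power of `t`.
  have hrt : (t ^ (1 / α))⁻¹ * t = t ^ (1 - 1 / α) := by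
    rw [Real.rpow_sub ht, Real.rpow_one]; ring
  set r := t ^ (1 / α) with hrdef
  set Φ := unitCharFun (scaledKernel α r K) (scaledDrift α r K) with hΦ
  set c := 1 / (2 * Real.pi) ^ d with hcdef
  have hc0 : 0 < c := by positivity
  rw [finrank_euclideanSpace_fin] at hb0 hb1
  refine ⟨?_, ?_, fun x => ⟨?_, ?_⟩⟩
  · simp only [hexp]
    exact hc.comp (continuous_const_smul r)
  · simp only [hexp]
    exact hi.comp_smul hr.ne'
  · have hprof := inv_pow_mul_profile_eq (s := α) hr x
    rw [hdens, abs_mul, abs_of_pos (by positivity)]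
    calc _ ≤ c * (r ^ d)⁻¹ * (C * profile ((d : ℝ) + α) (r⁻¹ • x)) := by
          gcongr
          exact (Complex.abs_re_le_norm _).trans (hb0 _)
      _ = c * C * ((r ^ d)⁻¹ * profile ((d : ℝ) + α) (r⁻¹ • x)) := by ring
      _ = _ := by rw [hprof, hrα]; ring
  · have hprof := inv_pow_mul_profile_eq (s := α) hr x
    obtain ⟨hF, hFe⟩ := hasFDerivAt_fourierI hi hi1 (r⁻¹ • x)
    have hder : HasFDerivAt (density α K t)
        ((c * (r ^ d)⁻¹) • (Complex.reCLM.comp ((fderiv ℝ (fourierI Φ) (r⁻¹ • x)).comp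
          (r⁻¹ • ContinuousLinearMap.id ℝ (Rd d))))) x := by
      rw [hdens]
      have h1 : HasFDerivAt (fun x : Rd d => r⁻¹ • x) (r⁻¹ • ContinuousLinearMap.id ℝ (Rd d)) x :=
        (hasFDerivAt_id x).const_smul r⁻¹
      exact (Complex.reCLM.hasFDerivAt.comp x (hF.comp x h1)).const_smul (c * (r ^ d)⁻¹)
    refine ⟨hder.differentiableAt, ?_⟩
    rw [gradient, LinearIsometryEquiv.norm_map, hder.fderiv]
    refine ContinuousLinearMap.opNorm_le_bound _ (by positivity) fun e => ?_
    simp only [ContinuousLinearMap.comp_apply, smul_apply, ContinuousLinearMap.id_apply,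
      hFe, norm_smul, Complex.reCLM_apply, Real.norm_eq_abs, abs_of_pos hc0, abs_mul, abs_inv,
      abs_of_pos hr, abs_pow]
    calc _ ≤ c * (r ^ d)⁻¹ * (r⁻¹ * (C * ‖e‖ * profile ((d : ℝ) + α) (r⁻¹ • x))) := by
          gcongr
          refine (Complex.abs_re_le_norm _).trans ?_
          rw [norm_mul, norm_neg, Complex.norm_I, one_mul]
          refine (hb1 _ _).trans_eq ?_
          rw [norm_smul, norm_inv, Real.norm_of_nonneg hr.le]
          ring
      _ = c * C * ((r ^ d)⁻¹ * profile ((d : ℝ) + α) (r⁻¹ • x)) * r⁻¹ * ‖e‖ := by ring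
      _ = _ := by rw [hprof, hrα, ← hrt]; ring

end Bounds

/-! ### Fourier inversion and identification of the law -/

section Inversion

variable {E : Type*} [NormedAddCommGroup E] [InnerProductSpace ℝ E] [FiniteDimensional ℝ E]
  [MeasurableSpace E] [BorelSpace E]

open scoped FourierTransform in
-- Mathlib's inversion formula after the dilation by `2π` that relates the two normalisations.
theorem integral_exp_mul_fourierI_eq {Ψ : E → ℂ} (hc : Continuous Ψ) (hi : Integrable Ψ)
    (hF : Integrable (fourierI Ψ)) (u : E) :
    ((1 / (2 * Real.pi) ^ finrank ℝ E : ℝ) : ℂ) *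
      ∫ x, Complex.exp (Complex.I * (inner ℝ x u : ℝ)) * fourierI Ψ x = Ψ u := by
  have hπ : (0 : ℝ) < 2 * Real.pi := by positivity
  have h1 : 𝓕 Ψ = fun w => fourierI Ψ ((2 * Real.pi) • w) := by
    ext w
    rw [Real.fourier_eq']
    refine integral_congr_ae (Eventually.of_forall fun v => ?_)
    simp only [smul_eq_mul, inner_smul_right]
    congr 2
    push_cast
    ring
  have h2 : Integrable (𝓕 Ψ) := by
    rw [h1]
    exact hF.comp_smul hπ.ne'
  have h3 := congrFun (hc.fourierInv_fourier_eq hi h2) u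
  rw [Real.fourierInv_eq', h1] at h3
  rw [← h3]
  have h4 := Measure.integral_comp_smul (volume : Measure E)
    (fun x => Complex.exp (Complex.I * (inner ℝ x u : ℝ)) * fourierI Ψ x) (2 * Real.pi)
  rw [abs_of_pos (by positivity), Complex.real_smul, ← one_div] at h4
  rw [← h4]
  refine integral_congr_ae (Eventually.of_forall fun v => ?_)
  simp only [smul_eq_mul, inner_smul_left]
  congr 2
  simp
  ring

theorem im_fourierI_eq_zero {Ψ : E → ℂ} (hΨ : ∀ u, Ψ (-u) = starRingEnd ℂ (Ψ u)) (x : E) :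
    (fourierI Ψ x).im = 0 := by
  rw [← Complex.conj_eq_iff_im, fourierI, ← integral_conj,
    ← integral_neg_eq_self (fun u => Complex.exp (-(Complex.I * (inner ℝ u x : ℝ))) * Ψ u)]
  refine integral_congr_ae (Eventually.of_forall fun u => ?_)
  simp only [map_mul, hΨ, ← Complex.exp_conj, map_neg, Complex.conj_I, Complex.conj_ofReal,
    inner_neg_left, Complex.ofReal_neg]
  congr 2
  ring

/-- As the sign of `f` is not known beforehand, its positive and negative parts define two finite
measures. Inversion gives `μ + νn = νp` at the level of characteristic functions, hence as measures.
But `νp` does not charge `{f < 0}`, so neither does `νn`, and `νn = 0`. -/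
theorem eq_withDensity_of_charFun {μ : Measure E} [IsFiniteMeasure μ] {Ψ : E → ℂ}
    (hΨ : ∀ u, ∫ x, Complex.exp (Complex.I * (inner ℝ x u : ℝ)) ∂μ = Ψ u)
    (hc : Continuous Ψ) (hi : Integrable Ψ) {f : E → ℝ}
    (hf : ∀ x, f x = 1 / (2 * Real.pi) ^ finrank ℝ E * (fourierI Ψ x).re)
    (hfc : Continuous f) (hfi : Integrable f) :
    (∀ x, 0 ≤ f x) ∧ μ = volume.withDensity fun x => ENNReal.ofReal (f x) := by
  have hconj : ∀ u, Ψ (-u) = starRingEnd ℂ (Ψ u) := fun u => by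
    rw [← hΨ, ← hΨ, ← integral_conj]
    refine integral_congr_ae (Eventually.of_forall fun x => ?_)
    simp only [← Complex.exp_conj, map_mul, Complex.conj_I, Complex.conj_ofReal, inner_neg_right,
      Complex.ofReal_neg, mul_neg, neg_mul]
  have hc0 : (0 : ℝ) < 1 / (2 * Real.pi) ^ finrank ℝ E := by positivity
  have hFf : ∀ x, fourierI Ψ x = ((1 / (2 * Real.pi) ^ finrank ℝ E : ℝ) : ℂ)⁻¹ * (f x : ℂ) :=
    fun x => by
      have h1 : ((fourierI Ψ x).re : ℂ) = fourierI Ψ x :=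
        Complex.ext (by simp) (by simp [im_fourierI_eq_zero hconj x])
      have h2 : ((1 / (2 * Real.pi) ^ finrank ℝ E : ℝ) : ℂ) ≠ 0 := by exact_mod_cast hc0.ne'
      rw [hf, Complex.ofReal_mul, h1, inv_mul_cancel_left₀ h2]
  have hFi : Integrable (fourierI Ψ) := by
    rw [funext hFf]
    exact (hfi.ofReal (𝕜 := ℂ)).const_mul _
  have hinv : ∀ u, ∫ x, Complex.exp (Complex.I * (inner ℝ x u : ℝ)) * (f x : ℂ) = Ψ u := fun u => by
    rw [← integral_exp_mul_fourierI_eq hc hi hFi u, ← integral_const_mul]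
    refine integral_congr_ae (Eventually.of_forall fun x => ?_)
    have h2 : ((1 / (2 * Real.pi) ^ finrank ℝ E : ℝ) : ℂ) ≠ 0 := by exact_mod_cast hc0.ne'
    simp only [hFf]
    field_simp
  have hdens : ∀ g : E → ℝ, Continuous g → Integrable g →
      IsFiniteMeasure (volume.withDensity fun x => ENNReal.ofReal (g x)) ∧ ∀ u : E,
      charFun (volume.withDensity fun x => ENNReal.ofReal (g x)) u
        = ∫ x, Complex.exp (Complex.I * (inner ℝ x u : ℝ)) * ((max (g x) 0 : ℝ) : ℂ) := by
    intro g hgc hgi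
    refine ⟨isFiniteMeasure_withDensity_ofReal hgi.2, fun u => ?_⟩
    rw [charFun_apply]
    have : (fun x => ENNReal.ofReal (g x)) = fun x => ((g x).toNNReal : ℝ≥0∞) := rfl
    rw [this, integral_withDensity_eq_integral_smul hgc.measurable.real_toNNReal]
    refine integral_congr_ae (Eventually.of_forall fun x => ?_)
    simp only [NNReal.smul_def, Real.coe_toNNReal', Complex.real_smul]
    rw [mul_comm, mul_comm Complex.I]
  obtain ⟨hfinp, hpos⟩ := hdens f hfc hfi
  obtain ⟨hfinn, hneg⟩ := hdens (fun x => -f x) hfc.neg hfi.neg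
  set νp := (volume : Measure E).withDensity fun x => ENNReal.ofReal (f x) with hνp
  set νn := (volume : Measure E).withDensity fun x => ENNReal.ofReal (-f x) with hνn
  have hint : ∀ (u : E) (g : E → ℝ), Continuous g → Integrable g →
      Integrable fun x => Complex.exp (Complex.I * (inner ℝ x u : ℝ)) * ((max (g x) 0 : ℝ) : ℂ) := by
    intro u g hgc hgi
    refine hgi.mono (Continuous.aestronglyMeasurable (by fun_prop)) (Eventually.of_forall fun x => ?_)
    rw [norm_mul, norm_exp_I_inner, one_mul, Complex.norm_real, Real.norm_eq_abs, Real.norm_eq_abs,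
      abs_of_nonneg (le_max_right _ _)]
    exact max_le (le_abs_self _) (abs_nonneg _)
  have hsum : μ + νn = νp := by
    refine Measure.ext_of_charFun (funext fun u => ?_)
    have hexpi : ∀ ν : Measure E, IsFiniteMeasure ν →
        Integrable (fun x : E => Complex.exp ((inner ℝ x u : ℝ) * Complex.I)) ν := fun ν _ =>
      (integrable_const (1 : ℝ)).mono' (Continuous.aestronglyMeasurable (by fun_prop))
        (Eventually.of_forall fun x => (Complex.norm_exp_ofReal_mul_I _).le)
    have hμ : charFun μ u = Ψ u := by
      rw [charFun_apply, ← hΨ]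
      simp only [mul_comm]
    have hadd : charFun (μ + νn) u = charFun μ u + charFun νn u := by
      simp only [charFun_apply]
      exact integral_add_measure (hexpi _ inferInstance) (hexpi _ inferInstance)
    have hfI : Integrable fun x => Complex.exp (Complex.I * (inner ℝ x u : ℝ)) * (f x : ℂ) := by
      refine hfi.mono (Continuous.aestronglyMeasurable (by fun_prop))
        (Eventually.of_forall fun x => ?_)
      rw [norm_mul, norm_exp_I_inner, one_mul, Complex.norm_real]
    rw [hadd, hμ, hneg, hpos, ← hinv]
    refine (integral_add hfI (hint u _ hfc.neg hfi.neg)).symm.trans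
      (integral_congr_ae (Eventually.of_forall fun x => ?_))
    simp only [Pi.neg_apply]
    rw [← mul_add, ← Complex.ofReal_add]
    congr 2
    rcases le_total 0 (f x) with h | h <;> simp [h]
  have hN : MeasurableSet {x | f x < 0} := measurableSet_lt hfc.measurable measurable_const
  have hνpN : νp {x | f x < 0} = 0 := by
    rw [hνp, withDensity_apply _ hN]
    refine setLIntegral_eq_zero hN fun x hx => ?_
    exact ENNReal.ofReal_of_nonpos (le_of_lt hx)
  have hνnN : νn {x | f x < 0} = 0 := by
    rw [← hsum, Measure.add_apply] at hνpN
    exact (add_eq_zero.1 hνpN).2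
  have hvol : volume {x | f x < 0} = 0 := by
    rw [hνn, withDensity_apply_eq_zero (by fun_prop)] at hνnN
    refine measure_mono_null (fun x hx => Set.mem_inter ?_ hx) hνnN
    have : f x < 0 := hx
    simpa using this
  -- Continuity makes `{f < 0}` open, so a null set is empty: nonnegativity holds everywhere, not
  -- just almost everywhere.
  have hempty := (IsOpen.measure_eq_zero_iff volume (isOpen_lt hfc continuous_const)).1 hvol
  have hnn : ∀ x, 0 ≤ f x := fun x => by
    by_contra h
    have : x ∈ {x | f x < 0} := not_le.1 h
    rw [hempty] at this
    exact this
  refine ⟨hnn, ?_⟩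
  have hz : νn = 0 := by
    rw [hνn]
    have : (fun x => ENNReal.ofReal (-f x)) = 0 :=
      funext fun x => ENNReal.ofReal_of_nonpos (by linarith [hnn x])
    rw [this, withDensity_zero]
  rw [← hsum, hz, add_zero]

end Inversion

theorem IsStableLikeProcess.map_eq_withDensity {d : ℕ} {α κ₀ κ₁ : ℝ} (hd : 1 ≤ d) (hα0 : 0 < α)
    (hα2 : α < 2) (hκ₀ : 0 < κ₀) (hκ₁ : 0 < κ₁) {K : Rd d → ℝ}
    (hK : IsStableLikeKernel α κ₀ κ₁ K) {Ω : Type*} [MeasurableSpace Ω] {P : Measure Ω}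
    [IsProbabilityMeasure P] {Z : ℝ≥0 → Ω → Rd d} (hZ : IsStableLikeProcess α K Z P) {t : ℝ≥0}
    (ht : 0 < t) :
    (∀ x, 0 ≤ density α K t x) ∧ P.map (Z t) = (volume : Measure (Rd d)).withDensity
      (fun x => ENNReal.ofReal (density α K t x)) := by
  obtain ⟨C, hC, hbd⟩ := exists_density_bounds (d := d) hd hα0 hα2 hκ₀ hκ₁
  have ht' : (0 : ℝ) < t := ht
  obtain ⟨hc, hi, hx⟩ := hbd K hK t ht'
  have hr : 0 < (t : ℝ) ^ (1 / α) := Real.rpow_pos_of_pos ht' _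
  have hfc : Continuous (density α K t) :=
    Differentiable.continuous (𝕜 := ℝ) fun x => (hx x).2.1
  have hfi : Integrable (density α K t) := by
    -- The pointwise upper bound is a multiple of a dilated profile of order `d + α > d`, which
    -- supplies the integrability required for inversion.
    have hp : Integrable fun x : Rd d => profile ((d : ℝ) + α) (((t : ℝ) ^ (1 / α))⁻¹ • x) :=
      (integrable_profile (by rw [finrank_euclideanSpace_fin]; linarith)).comp_smul
        (inv_ne_zero hr.ne')
    refine (hp.const_mul (C * t * ((((t : ℝ) ^ (1 / α)) ^ α)⁻¹ * (((t : ℝ) ^ (1 / α)) ^ d)⁻¹))).mono'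
      hfc.aestronglyMeasurable (Eventually.of_forall fun x => ?_)
    rw [Real.norm_eq_abs]
    refine (hx x).1.trans_eq ?_
    have h0 : ((t : ℝ) ^ (1 / α)) ^ α ≠ 0 := (Real.rpow_pos_of_pos hr _).ne'
    rw [mul_assoc _ _ (profile _ _), mul_assoc _ _ (profile _ _), inv_pow_mul_profile_eq hr,
      inv_mul_cancel_left₀ h0]
  have hm := hZ.levy.measurable t
  have : IsProbabilityMeasure (P.map (Z t)) := Measure.isProbabilityMeasure_map hm.aemeasurable
  refine eq_withDensity_of_charFun (Ψ := fun u => Complex.exp (-(((t : ℝ) : ℂ) * psi α K u)))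
    (fun u => ?_) hc hi (fun x => ?_) hfc hfi
  · rw [integral_map hm.aemeasurable (Continuous.aestronglyMeasurable (by fun_prop)),
      hZ.charFun_eq]
  · rw [finrank_euclideanSpace_fin]
    rfl

end StableLike

theorem mainTheorem5 (d : ℕ) (hd : 1 ≤ d) (α : ℝ) (hα0 : 0 < α) (hα2 : α < 2)
    (κ₀ κ₁ : ℝ) (hκ₀ : 0 < κ₀) (hκ : κ₀ < κ₁) :
    ∃ C₁ : ℝ, 0 < C₁ ∧ ∃ C₂ : ℝ, 0 < C₂ ∧
      ∀ K : StableLike.Rd d → ℝ, StableLike.IsStableLikeKernel α κ₀ κ₁ K →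
        -- the integral that defines `f_t` converges absolutely
        (∀ t : ℝ, 0 < t →
          Integrable (fun u : StableLike.Rd d =>
            Complex.exp (-((t : ℂ) * StableLike.psi α K u))) volume) ∧
        -- `f_t` is the density of `Z_t` for every Lévy process `Z` with exponent `ψ`
        (∀ (Ω : Type*) [MeasurableSpace Ω] (P : Measure Ω) [IsProbabilityMeasure P]
          (Z : ℝ≥0 → Ω → StableLike.Rd d), StableLike.IsStableLikeProcess α K Z P →
          ∀ t : ℝ≥0, 0 < t →
            (∀ x, 0 ≤ StableLike.density α K t x) ∧
            P.map (Z t) = (volume : Measure (StableLike.Rd d)).withDensity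
              (fun x => ENNReal.ofReal (StableLike.density α K t x))) ∧
        -- the upper bound
        (∀ (t : ℝ) (x : StableLike.Rd d), 0 < t →
          StableLike.density α K t x
            ≤ C₁ * t * (t ^ (1 / α) + ‖x‖) ^ (-(d : ℝ) - α)) ∧
        -- the gradient bound
        (∀ (t : ℝ) (x : StableLike.Rd d), 0 < t →
          DifferentiableAt ℝ (StableLike.density α K t) x ∧
          ‖gradient (StableLike.density α K t) x‖
            ≤ C₂ * t ^ (1 - 1 / α) * (t ^ (1 / α) + ‖x‖) ^ (-(d : ℝ) - α)) := by
  have hκ₁ := hκ₀.trans hκ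
  obtain ⟨C, hC, h⟩ := StableLike.exists_density_bounds hd hα0 hα2 hκ₀ hκ₁
  exact ⟨C, hC, C, hC, fun K hK => ⟨fun t ht => (h K hK t ht).2.1,
    fun Ω _ P _ Z hZ t ht => hZ.map_eq_withDensity hd hα0 hα2 hκ₀ hκ₁ hK ht,
    fun t x ht => (le_abs_self _).trans ((h K hK t ht).2.2 x).1,
    fun t x ht => ((h K hK t ht).2.2 x).2⟩⟩
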